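/- Conventions. Let $\mathcal{A}n$ be the category of complex analytic manifolds (Hausdorff, second countable, of some finite dimension) and analytic maps. A \emph{prestack} is a $2$-functor $\mathcal{A}n^{\mathrm{op}}\to\text{Groupoids}$ (equivalently, a category fibred in groupoids over $\mathcal{A}n$), and a \emph{stack} is a prestack in which morphisms and objects can be glued along open coverings. A manifold $X$ is viewed as the stack $S\mapsto \mathrm{Mor}(S,X)$. A morphism of stacks $\mathcal{Y}\to\mathcal{X}$ is \emph{representable} if, for every manifold $S$ and every $S\to\mathcal{X}$, the fibre product $S\times_{\mathcal{X}}\mathcal{Y}$ is isomorphic to a manifold; a representable morphism is a \emph{submersion} (respectively, an \emph{open substack}) if all the maps of manifolds $S\times_{\mathcal{X}}\mathcal{Y}\to S$ are submersions (respectively, open maps). A morphism of prestacks $F:\mathcal{Y}\to\mathcal{X}$ is \emph{surjective} if for all $S$ and all $P\in\mathcal{X}(S)$ there is an open covering $(S_i)$ of $S$ such that each $P|_{S_i}$ is isomorphic to an object $F_{S_i}(P_i)$ with $P_i\in\mathcal{Y}(S_i)$. An \emph{analytic stack} is a stack $\mathcal{X}$ with a representable surjective submersion $X\to\mathcal{X}$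 from a manifold $X$ (an \emph{atlas}). If a discrete group $G$ acts on a manifold $X$ to the right by automorphisms, $[X/G](S)$ is the groupoid of pairs $(P,u)$ of a principal $G$-bundle $P\to S$ and a $G$-equivariant analytic map $u:P\to X$. An \emph{analytic orbifold} is an analytic stack $\mathcal{X}$ with a family of open substacks $F_i:[U_i/\Gamma_i]\to\mathcal{X}$, where each $\Gamma_i$ is a finite group acting on a manifold $U_i$ by automorphisms, such that $\bigsqcup_i[U_i/\Gamma_i]\to\mathcal{X}$ is surjective (the group actions need not be effective). Theorem. Let $X$ be a complex analytic manifold and let $G$ be a discrete group acting to the right on $X$ by automorphisms. For $x\in X$ let $G_x:=\{g\in G\mid x\cdot g=x\}$. Assume that: (1) for every $x\in X$ there is given an open neighbourhood $U_x$ of $x$ such that $U_x\cdot g\subset U_x$ for all $g\in G_x$ and $(U_x\cdot g)\cap U_x=\emptyset$ for all $g\in G\setminus G_x$; (2) for every $x\in X$ the group $G_x$ is finite. Then the quotient stack $[X/G]$ is an analytic orbifold. More precisely, $[X/G]$ is a stack, the canonical morphism $X\to[X/G]$ (given by the trivial bundle $X\times G$ and the action map $X\times G\to X$) is an atlas, and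 together with the canonical morphisms $[U_x/G_x]\to[X/G]$, $P\mapsto P\times_{G_x}G$, for $x\in X$, which are open substacks and are jointly surjective (that is, $\bigsqcup_{x\in X}[U_x/G_x]\to[X/G]$ is surjective), it makes $[X/G]$ an analytic orbifold. -/

import Mathlib

open CategoryTheory TopologicalSpace
open scoped Manifold ContDiff

universe v w u

namespace OrbiStack

noncomputable section

/-! ### The category of complex analytic manifolds -/

/-- A complex analytic manifold: a Hausdorff, second countable space with a holomorphic atlas
modelled on `ℂⁿ`. It may be empty and it need not be connected. -/
structure An : Type (u + 1) where
  carrier : Type u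
  dim : ℕ
  [topology : TopologicalSpace carrier]
  [t2 : T2Space carrier]
  [secondCountable : SecondCountableTopology carrier]
  [charted : ChartedSpace (EuclideanSpace ℂ (Fin dim)) carrier]
  [isManifold : IsManifold 𝓘(ℂ, EuclideanSpace ℂ (Fin dim)) ω carrier]

namespace An

instance : CoeSort An.{u} (Type u) := ⟨An.carrier⟩

instance (S : An.{u}) : TopologicalSpace S := S.topology
instance (S : An.{u}) : T2Space S := S.t2
instance (S : An.{u}) : SecondCountableTopology S := S.secondCountable
instance (S : An.{u}) : ChartedSpace (EuclideanSpace ℂ (Fin S.dim)) S := S.charted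
instance (S : An.{u}) : IsManifold 𝓘(ℂ, EuclideanSpace ℂ (Fin S.dim)) ω S := S.isManifold

/-- The model with corners of `S`, that is, `ℂⁿ` without boundary. -/
abbrev model (S : An.{u}) :
    ModelWithCorners ℂ (EuclideanSpace ℂ (Fin S.dim)) (EuclideanSpace ℂ (Fin S.dim)) :=
  𝓘(ℂ, EuclideanSpace ℂ (Fin S.dim))

/-- Morphisms of complex analytic manifolds are the analytic maps. -/
@[ext]
structure Hom (S T : An.{u}) : Type u where
  toFun : S → T
  analytic : ContMDiff S.model T.model ω toFun

instance : Category.{u} An.{u} where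
  Hom S T := Hom S T
  id S := ⟨id, contMDiff_id⟩
  comp f g := ⟨g.toFun ∘ f.toFun, g.analytic.comp f.analytic⟩

instance (S T : An.{u}) : CoeFun (S ⟶ T) (fun _ => S → T) := ⟨Hom.toFun⟩

/-- An open subset of a manifold, as a manifold. -/
def openSub (S : An.{u}) (U : Opens S) : An.{u} where
  carrier := U
  dim := S.dim

/-- The inclusion of an open subset. -/
def incl (S : An.{u}) (U : Opens S) : S.openSub U ⟶ S :=
  ⟨fun x : U => (x : S),
    show ContMDiff S.model S.model ω (Subtype.val : U → S) from contMDiff_subtype_val⟩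

/-- The inclusion of an open subset into a larger one. -/
def inclOfLE (S : An.{u}) {U V : Opens S} (h : U ≤ V) : S.openSub U ⟶ S.openSub V :=
  ⟨Opens.inclusion h,
    show ContMDiff S.model S.model ω (Opens.inclusion h : U → V) from contMDiff_inclusion h⟩

/-- A submersion in the category of complex analytic manifolds. -/
def IsSubmersion {S T : An.{u}} (f : S ⟶ T) : Prop :=
  Manifold.IsSubmersion S.model T.model ω f.toFun

/-- The category fibred in sets over the category of manifolds that is represented by `X`: its
objects over `S` are the morphisms `S ⟶ X`. -/
abbrev toStack (X : An.{u}) : BasedCategory.{u, u + 1} An.{u} where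
  obj := Over X
  p := Over.forget X

end An

/-! ### Stacks over the category of complex analytic manifolds

A prestack (a 2-functor from `Anᵒᵖ` to groupoids) is given as a category fibred in groupoids over
`An`: `𝒳.p.obj a = S` means that `a` is an object of the groupoid `𝒳(S)`, a morphism in `𝒳(S)` is
a morphism over `𝟙 S`, and a morphism `b ⟶ a` over `f : T ⟶ S` exhibits `b` as the
pullback `f^* a`. A morphism of prestacks is a functor over `An`, and an isomorphism of (pre)stacks
is an equivalence over `An`. -/

/-- A stack on `An`. In `glue_hom`, the `α i : a' i ⟶ a` exhibit `a' i` as the restriction of `a` to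
`U i`, and the morphism `φ i : a' i ⟶ b` over the inclusion stands for a morphism of restrictions
`a|_{U i} ⟶ b|_{U i}`. In `glue_obj`, the object `c i j` over `U i ⊓ U j` with its morphisms
`l i j` and `r i j` exhibits it both as the restriction of `a i` and as the restriction of `a j`,
that is, it stands for an isomorphism `φ_{ij}` from `a j` to `a i` over `U i ⊓ U j`;
`l i i = r i i` says `φ_{ii} = id`, and the next condition says `φ_{ij} ∘ φ_{jk} = φ_{ik}`
over `U i ⊓ U j ⊓ U k`. -/
structure IsStack (𝒳 : BasedCategory.{v, w} An.{u}) : Prop where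
  fibered : 𝒳.p.IsFibered
  groupoid : ∀ (S : An.{u}) (a b : 𝒳.obj) (φ : a ⟶ b), 𝒳.p.IsHomLift (𝟙 S) φ → IsIso φ
  glue_hom : ∀ (S : An.{u}) (ι : Type u) (U : ι → Opens S), ⨆ i, U i = ⊤ →
    ∀ (a b : 𝒳.obj), 𝒳.p.obj a = S → 𝒳.p.obj b = S →
    ∀ (a' : ι → 𝒳.obj) (α : ∀ i, a' i ⟶ a) (φ : ∀ i, a' i ⟶ b),
      (∀ i, 𝒳.p.IsHomLift (S.incl (U i)) (α i)) →
      (∀ i, 𝒳.p.IsHomLift (S.incl (U i)) (φ i)) →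
      (∀ (i j : ι) (c : 𝒳.obj) (l : c ⟶ a' i) (r : c ⟶ a' j),
        𝒳.p.IsHomLift (S.inclOfLE (inf_le_left : U i ⊓ U j ≤ U i)) l →
        𝒳.p.IsHomLift (S.inclOfLE (inf_le_right : U i ⊓ U j ≤ U j)) r →
        l ≫ α i = r ≫ α j → l ≫ φ i = r ≫ φ j) →
      ∃! ψ : a ⟶ b, 𝒳.p.IsHomLift (𝟙 S) ψ ∧ ∀ i, α i ≫ ψ = φ i
  glue_obj : ∀ (S : An.{u}) (ι : Type u) (U : ι → Opens S), ⨆ i, U i = ⊤ →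
    ∀ (a : ι → 𝒳.obj), (∀ i, 𝒳.p.obj (a i) = S.openSub (U i)) →
    ∀ (c : ι → ι → 𝒳.obj) (l : ∀ i j, c i j ⟶ a i) (r : ∀ i j, c i j ⟶ a j),
      (∀ i j, 𝒳.p.IsHomLift (S.inclOfLE (inf_le_left : U i ⊓ U j ≤ U i)) (l i j)) →
      (∀ i j, 𝒳.p.IsHomLift (S.inclOfLE (inf_le_right : U i ⊓ U j ≤ U j)) (r i j)) →
      (∀ i, l i i = r i i) →
      (∀ (i j k : ι) (d : 𝒳.obj) (x : d ⟶ c i j) (y : d ⟶ c j k) (z : d ⟶ c i k),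
        𝒳.p.IsHomLift (S.inclOfLE (inf_le_left : U i ⊓ U j ⊓ U k ≤ U i ⊓ U j)) x →
        𝒳.p.IsHomLift (S.inclOfLE
          (inf_le_inf_right (U k) inf_le_right : U i ⊓ U j ⊓ U k ≤ U j ⊓ U k)) y →
        𝒳.p.IsHomLift (S.inclOfLE
          (inf_le_inf_right (U k) inf_le_left : U i ⊓ U j ⊓ U k ≤ U i ⊓ U k)) z →
        x ≫ l i j = z ≫ l i k → x ≫ r i j = y ≫ l j k → y ≫ r j k = z ≫ r i k) →
      ∃ (b : 𝒳.obj) (β : ∀ i, a i ⟶ b), 𝒳.p.obj b = S ∧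
        (∀ i, 𝒳.p.IsHomLift (S.incl (U i)) (β i)) ∧
        ∀ i j, l i j ≫ β i = r i j ≫ β j

/-- The fibre product of two morphisms of prestacks. Its objects over `S` are the triples
`(a, b, φ)` with `a` and `b` over `S` and `φ : F a ≅ G b` an isomorphism over `𝟙 S`; its morphisms
are the pairs of morphisms that are compatible with the isomorphisms `φ`. -/
def fibreProduct {𝒜 ℬ 𝒳 : BasedCategory.{u, u + 1} An.{u}} (F : 𝒜 ⥤ᵇ 𝒳) (G : ℬ ⥤ᵇ 𝒳) :
    BasedCategory.{u, u + 1} An.{u} where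
  obj := ObjectProperty.FullSubcategory (C := Comma F.toFunctor G.toFunctor) fun c =>
    IsIso c.hom ∧ 𝒳.p.IsHomLift (𝟙 (𝒜.p.obj c.left)) c.hom
  p := ObjectProperty.ι _ ⋙ Comma.fst F.toFunctor G.toFunctor ⋙ 𝒜.p

/-- The first projection of a fibre product. -/
def fibreProductFst {𝒜 ℬ 𝒳 : BasedCategory.{u, u + 1} An.{u}} (F : 𝒜 ⥤ᵇ 𝒳) (G : ℬ ⥤ᵇ 𝒳) :
    fibreProduct F G ⥤ᵇ 𝒜 where
  toFunctor := ObjectProperty.ι _ ⋙ Comma.fst F.toFunctor G.toFunctor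
  w := rfl

/-- The morphism of manifolds `f : M ⟶ S` is a base change of the morphism of stacks
`F : 𝒴 ⥤ᵇ 𝒳` along `g : S ⥤ᵇ 𝒳`: there is an isomorphism of `M` with `S ×_𝒳 𝒴`
whose composition with the projection to `S` is `f`. -/
def IsBaseChange {𝒳 𝒴 : BasedCategory.{u, u + 1} An.{u}} (F : 𝒴 ⥤ᵇ 𝒳) {S M : An.{u}}
    (g : S.toStack ⥤ᵇ 𝒳) (f : M ⟶ S) : Prop :=
  ∃ E : M.toStack ⥤ᵇ fibreProduct g F, E.toFunctor.IsEquivalence ∧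
    E.toFunctor ⋙ (fibreProductFst g F).toFunctor = Over.map f

/-- A representable morphism of stacks: every base change to a manifold is a manifold. -/
def IsRepresentable {𝒳 𝒴 : BasedCategory.{u, u + 1} An.{u}} (F : 𝒴 ⥤ᵇ 𝒳) : Prop :=
  ∀ (S : An.{u}) (g : S.toStack ⥤ᵇ 𝒳), ∃ (M : An.{u}) (f : M ⟶ S), IsBaseChange F g f

/-- A surjective morphism: every object over `S` is, locally on `S`, in the essential image. (A
morphism from `F m` to `a` over the inclusion of `U i` is an isomorphism of `F m` with the
restriction of `a` to `U i`.) -/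
def IsSurjective {𝒳 : BasedCategory.{u, u + 1} An.{u}} {𝒴 : BasedCategory.{v, w} An.{u}}
    (F : 𝒴 ⥤ᵇ 𝒳) : Prop :=
  ∀ (S : An.{u}) (a : 𝒳.obj), 𝒳.p.obj a = S →
    ∃ (ι : Type u) (U : ι → Opens S), ⨆ i, U i = ⊤ ∧
      ∀ i, ∃ (m : 𝒴.obj) (φ : F.obj m ⟶ a), 𝒳.p.IsHomLift (S.incl (U i)) φ

/-- A submersion of stacks. -/
def IsStackSubmersion {𝒳 𝒴 : BasedCategory.{u, u + 1} An.{u}} (F : 𝒴 ⥤ᵇ 𝒳) : Prop :=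
  IsRepresentable F ∧ ∀ (S M : An.{u}) (g : S.toStack ⥤ᵇ 𝒳) (f : M ⟶ S),
    IsBaseChange F g f → An.IsSubmersion f

/-- An open substack: a representable morphism from a stack, all of whose base changes to manifolds
are open maps. -/
structure IsOpenSubstack {𝒳 𝒴 : BasedCategory.{u, u + 1} An.{u}} (F : 𝒴 ⥤ᵇ 𝒳) : Prop where
  isStack : IsStack 𝒴
  representable : IsRepresentable F
  isOpenMap : ∀ (S M : An.{u}) (g : S.toStack ⥤ᵇ 𝒳) (f : M ⟶ S),
    IsBaseChange F g f → IsOpenMap f.toFun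

/-- `𝒳`, with the atlas `p : X ⥤ᵇ 𝒳`, is an analytic stack. -/
structure IsAnalyticStack (𝒳 : BasedCategory.{u, u + 1} An.{u}) {X : An.{u}}
    (p : X.toStack ⥤ᵇ 𝒳) : Prop where
  isStack : IsStack 𝒳
  representable : IsRepresentable p
  surjective : IsSurjective p
  submersion : IsStackSubmersion p

/-- The disjoint union of a family of prestacks, `(⊔ᵢ 𝒳ᵢ)(S) = ⊔ᵢ 𝒳ᵢ(S)`. -/
def disjointUnion {ι : Type u} (𝒳 : ι → BasedCategory.{u, u + 1} An.{u}) :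
    BasedCategory.{u + 1, u + 1} An.{u} where
  obj := Σ i, (𝒳 i).obj
  p := Sigma.desc fun i => (𝒳 i).p

/-- The morphism from a disjoint union that is given by a family of morphisms. -/
def disjointUnionDesc {ι : Type u} {𝒴 : ι → BasedCategory.{u, u + 1} An.{u}}
    {𝒳 : BasedCategory.{u, u + 1} An.{u}} (F : ∀ i, 𝒴 i ⥤ᵇ 𝒳) : disjointUnion 𝒴 ⥤ᵇ 𝒳 where
  toFunctor := Sigma.desc fun i => (F i).toFunctor
  w := by
    refine CategoryTheory.Functor.ext (fun a => (F a.1).w_obj a.2) ?_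
    rintro ⟨i, a⟩ ⟨_, b⟩ ⟨φ⟩
    exact Functor.congr_hom (F i).w φ

/-! ### Group actions, principal bundles and quotient stacks -/

/-- A right action of the (discrete) group `G` on `X` by analytic automorphisms; `act g` is the
map `x ↦ x · g`. -/
structure RightAction (G : Type u) [Group G] (X : An.{u}) where
  act : G → (X ⟶ X)
  act_one : act 1 = 𝟙 X
  act_mul : ∀ g h : G, act (g * h) = act g ≫ act h

namespace RightAction

variable {G : Type u} [Group G] {X : An.{u}} (ρ : RightAction G X)

/-- The stabiliser of a point. -/
def stabilizer (x : X) : Subgroup G where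
  carrier := {g | ρ.act g x = x}
  one_mem' := by
    change (ρ.act 1).toFun x = x
    rw [ρ.act_one]
    rfl
  mul_mem' {g h} hg hh := by
    change (ρ.act (g * h)).toFun x = x
    rw [ρ.act_mul]
    change (ρ.act h).toFun ((ρ.act g).toFun x) = x
    rw [show (ρ.act g).toFun x = x from hg, show (ρ.act h).toFun x = x from hh]
  inv_mem' {g} hg := by
    change (ρ.act g⁻¹).toFun x = x
    have key : (ρ.act (g * g⁻¹)).toFun x = x := by
      rw [mul_inv_cancel, ρ.act_one]
      rfl
    rw [ρ.act_mul] at key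
    change (ρ.act g⁻¹).toFun ((ρ.act g).toFun x) = x at key
    rwa [show (ρ.act g).toFun x = x from hg] at key

/-- The action of a subgroup `H` on an `H`-invariant open subset. -/
def restrict (H : Subgroup G) (Y : Opens X) (hY : ∀ h ∈ H, ∀ y ∈ Y, ρ.act h y ∈ Y) :
    RightAction H (X.openSub Y) where
  act h := ⟨fun y : Y => (⟨ρ.act h y, hY h h.2 y y.2⟩ : Y),
    show ContMDiff X.model X.model ω (fun y : Y => (⟨ρ.act h y, hY h h.2 y y.2⟩ : Y)) from
      fun y => ChartedSpace.liftPropWithinAt_subtypeVal_comp_iff .. |>.1 <|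
        ((ρ.act h).analytic.comp (X.incl Y).analytic) y⟩
  act_one := An.Hom.ext <| funext fun y : Y => Subtype.ext <| by
    change (ρ.act 1).toFun (y : X) = y
    rw [ρ.act_one]
    rfl
  act_mul g h := An.Hom.ext <| funext fun y : Y => Subtype.ext <| by
    change (ρ.act (g * h : G)).toFun (y : X) = (ρ.act h).toFun ((ρ.act g).toFun (y : X))
    rw [ρ.act_mul]
    rfl

end RightAction

/-- A principal `G`-bundle on `S`, for a discrete group `G`. Local triviality: near every point there
is an open set `V` and a section `σ` over `V`, which is an open map, such that `(s, g) ↦ σ s · g` is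
a bijection from `V × G` to the preimage of `V`; as `G` is discrete, this bijection is then an
equivariant biholomorphic map over `V`. -/
structure PrincipalBundle (G : Type u) [Group G] (S : An.{u}) where
  total : An.{u}
  proj : total ⟶ S
  action : RightAction G total
  act_proj : ∀ g, action.act g ≫ proj = proj
  locally_trivial : ∀ s : S, ∃ (V : Opens S) (σ : S.openSub V ⟶ total), s ∈ V ∧
    σ ≫ proj = S.incl V ∧ IsOpenMap σ.toFun ∧
    ∀ q : total, ∀ hq : proj q ∈ V, ∃! g : G, action.act g (σ.toFun (⟨proj q, hq⟩ : V)) = q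

section QuotientStack

variable {G : Type u} [Group G] {X : An.{u}} (ρ : RightAction G X)

/-- An object of the quotient stack `[X/G]` over `base`: a principal `G`-bundle on `base` with an
equivariant map to `X`. -/
structure QuotientObj where
  base : An.{u}
  bundle : PrincipalBundle G base
  toX : bundle.total ⟶ X
  equivariant : ∀ g, bundle.action.act g ≫ toX = toX ≫ ρ.act g

variable {ρ}

/-- A morphism of the quotient stack over `f : S ⟶ T`: a `G`-equivariant map of total spaces over
`f` that is compatible with the maps to `X`. (It identifies the first bundle with the pullback of
the second one along `f`.) -/
@[ext]
structure QuotientHom (P Q : QuotientObj ρ) where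
  base : P.base ⟶ Q.base
  total : P.bundle.total ⟶ Q.bundle.total
  comm : total ≫ Q.bundle.proj = P.bundle.proj ≫ base
  equivariant : ∀ g, P.bundle.action.act g ≫ total = total ≫ Q.bundle.action.act g
  toX : total ≫ Q.toX = P.toX

instance : Category.{u} (QuotientObj ρ) where
  Hom P Q := QuotientHom P Q
  id P := ⟨𝟙 _, 𝟙 _, by simp, by simp, by simp⟩
  comp f g := ⟨f.base ≫ g.base, f.total ≫ g.total,
    by rw [Category.assoc, g.comm, ← Category.assoc, f.comm, Category.assoc],
    fun x => by
      rw [← Category.assoc, f.equivariant, Category.assoc, g.equivariant, Category.assoc],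
    by rw [Category.assoc, g.toX, f.toX]⟩
  id_comp f := QuotientHom.ext (Category.id_comp _) (Category.id_comp _)
  comp_id f := QuotientHom.ext (Category.comp_id _) (Category.comp_id _)
  assoc f g h := QuotientHom.ext (Category.assoc _ _ _) (Category.assoc _ _ _)

variable (ρ)

/-- The quotient stack `[X/G]`. -/
def quotientStack : BasedCategory.{u, u + 1} An.{u} where
  obj := QuotientObj ρ
  p := { obj := fun P => P.base
         map := fun f => QuotientHom.base f }

/-- `p : X ⥤ᵇ [X/G]` is the canonical atlas: it sends the identity of `X` to the trivial bundle
`X × G` with the action map `(x, g) ↦ x · g`, as is witnessed by a section `x ↦ (x, 1)` of the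
bundle whose composition with the equivariant map to `X` is the identity. -/
def IsCanonicalAtlas (p : X.toStack ⥤ᵇ quotientStack ρ) : Prop :=
  let P : QuotientObj ρ := p.obj (Over.mk (𝟙 X))
  ∃ (hX : X = P.base) (σ : X ⟶ P.bundle.total),
    σ ≫ P.bundle.proj = eqToHom hX ∧ σ ≫ P.toX = 𝟙 X

/-- `F : [Y/H] ⥤ᵇ [X/G]`, for a subgroup `H` of `G` and an `H`-invariant open subset `Y` of `X`, is
the canonical morphism, that is, the extension of the structure group `P ↦ P ×_H G`: there are maps
`η P : P ⟶ F P` over the base of `P` (the maps `ξ ↦ [ξ, 1]`) that are `H`-equivariant, compatible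
with the maps to `X`, and natural in `P`. (Such a map induces an isomorphism from `P ×_H G` to `F P`,
so `F` is determined up to a unique isomorphism.) -/
def IsCanonicalMap (H : Subgroup G) (Y : Opens X) (hY : ∀ h ∈ H, ∀ y ∈ Y, ρ.act h y ∈ Y)
    (F : quotientStack (ρ.restrict H Y hY) ⥤ᵇ quotientStack ρ) : Prop :=
  let F₀ : QuotientObj (ρ.restrict H Y hY) → QuotientObj ρ := F.obj
  let F₁ : ∀ {P Q : QuotientObj (ρ.restrict H Y hY)}, (P ⟶ Q) → QuotientHom (F₀ P) (F₀ Q) := F.map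
  ∃ η : ∀ P : QuotientObj (ρ.restrict H Y hY), P.bundle.total ⟶ (F₀ P).bundle.total,
    (∀ P, ∃ hb : P.base = (F₀ P).base,
      η P ≫ (F₀ P).bundle.proj = P.bundle.proj ≫ eqToHom hb) ∧
    (∀ P (h : H), P.bundle.action.act h ≫ η P = η P ≫ (F₀ P).bundle.action.act h) ∧
    (∀ P, η P ≫ (F₀ P).toX = P.toX ≫ X.incl Y) ∧
    ∀ (P Q : QuotientObj (ρ.restrict H Y hY)) (m : P ⟶ Q),
      QuotientHom.total m ≫ η Q = η P ≫ (F₁ m).total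

end QuotientStack

/-! ### Analytic orbifolds -/

/-- `𝒳`, with the atlas `p : X ⥤ᵇ 𝒳` and the family `F i : [U i / Γ i] ⥤ᵇ 𝒳`, is an analytic
orbifold. -/
structure IsAnalyticOrbifold (𝒳 : BasedCategory.{u, u + 1} An.{u}) {X : An.{u}}
    (p : X.toStack ⥤ᵇ 𝒳) {ι : Type u} {U : ι → An.{u}} {Γ : ι → Type u} [∀ i, Group (Γ i)]
    (ρ : ∀ i, RightAction (Γ i) (U i)) (F : ∀ i, quotientStack (ρ i) ⥤ᵇ 𝒳) : Prop where
  isAnalyticStack : IsAnalyticStack 𝒳 p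
  finite : ∀ i, Finite (Γ i)
  isOpenSubstack : ∀ i, IsOpenSubstack (F i)
  surjective : IsSurjective (disjointUnionDesc F)

end

end OrbiStack

open OrbiStack

/-! For a discrete group the projection of a principal bundle is a local isomorphism
(`PrincipalBundle.isEtale_proj`). A continuous lift of an analytic map through an étale map is
analytic (`An.IsEtale.analytic_lift`), and a local homeomorphism to a manifold pulls back the
complex structure (`An.etaleSpace`). So bundles and their morphisms can be constructed
topologically, and analyticity comes for free.

Stack: a morphism of bundles is bijective on fibres, so every morphism is cartesian
(`QuotientHom.existsUnique_lift`) and is invertible as soon as its base is. Morphisms glue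
pointwise. Objects glue by dividing the disjoint union of the total spaces by the relation that the
descent datum defines (`glue_obj_quotientStack`).

Countability: `X × G` is a manifold in the present sense only if it is second countable. If `x` is a
point of `X`, the translates of `U x` by representatives of the cosets of the finite group `G_x` are
disjoint nonempty open sets of a second countable space, so `G` is countable
(`countable_of_disjoint_translates`). If `X` is empty, so is every total space that maps to it, and
no condition on `G` is needed.

Atlas: if `S → [X/G]` classifies a bundle `P` with equivariant map `u : P → X`, then a lift of `T →
S` to `P` is the same as a trivialisation of the pull-back of `P` to `T`. Hence `S ×_{[X/G]} X` is
`P`, which is étale over `S` (`isBaseChange_atlas`).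

Open substacks: let `Y` be invariant under `H` and disjoint from its translates by the elements
outside `H`. Over the open set of those `s` whose fibre meets `u⁻¹(Y)`, the set `u⁻¹(Y)` is a
reduction of `P` to the group `H`, and it is universal among such reductions. Hence the base change
of `[Y/H] → [X/G]` is the inclusion of that open set (`isBaseChange_extensionFunctor`). Base changes
are unique up to isomorphism over `S` (`IsBaseChange.exists_iso`), so one computed base change
decides the property for all. -/

namespace OrbiStack

/-! ### Étale maps of manifolds -/

section LocalDiffeomorphism

variable {E E' E'' H H' H'' : Type*} [NormedAddCommGroup E] [NormedSpace ℂ E]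
  [NormedAddCommGroup E'] [NormedSpace ℂ E'] [NormedAddCommGroup E''] [NormedSpace ℂ E'']
  [TopologicalSpace H] [TopologicalSpace H'] [TopologicalSpace H'']
  {I : ModelWithCorners ℂ E H} {J : ModelWithCorners ℂ E' H'} {K : ModelWithCorners ℂ E'' H''}
  {M N P : Type*} [TopologicalSpace M] [ChartedSpace H M] [TopologicalSpace N] [ChartedSpace H' N]
  [TopologicalSpace P] [ChartedSpace H'' P]

theorem isLocalDiffeomorphAt_congr {f g : M → N} {x : M} {n : WithTop ℕ∞}
    (hf : IsLocalDiffeomorphAt I J n f x) (h : f =ᶠ[nhds x] g) :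
    IsLocalDiffeomorphAt I J n g x := by
  obtain ⟨Φ, hx, hΦ⟩ := hf
  obtain ⟨O, hO, hOo, hxO⟩ := eventually_nhds_iff.1 h
  refine ⟨{ toPartialEquiv := (Φ.toOpenPartialHomeomorph.restrOpen O hOo).toPartialEquiv
            open_source := (Φ.toOpenPartialHomeomorph.restrOpen O hOo).open_source
            open_target := (Φ.toOpenPartialHomeomorph.restrOpen O hOo).open_target
            contMDiffOn_toFun := Φ.contMDiffOn_toFun.mono fun y hy => hy.1
            contMDiffOn_invFun := Φ.contMDiffOn_invFun.mono fun y hy => hy.1 }, ⟨hx, hxO⟩, ?_⟩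
  intro y hy
  exact (hO y hy.2).symm.trans (hΦ hy.1)

/-- Near `x`, `f` is `g ∘ f` followed by the local inverse of `g`. Continuity of `f` keeps its
values in the domain where that inverse applies. -/
theorem isLocalDiffeomorphAt_of_comp {f : M → N} {g : N → P} {x : M} {n : WithTop ℕ∞}
    (hf : ContinuousAt f x) (hgf : IsLocalDiffeomorphAt I K n (g ∘ f) x)
    (hg : IsLocalDiffeomorphAt J K n g (f x)) : IsLocalDiffeomorphAt I J n f x := by
  have h := IsLocalDiffeomorphAt.comp _ _ hgf (g := hg.localInverse) hg.localInverse_isLocalDiffeomorphAt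
  refine isLocalDiffeomorphAt_congr h ?_
  filter_upwards [hf.eventually hg.localInverse_eventuallyEq_left] with y hy using hy

end LocalDiffeomorphism

namespace An

/-- A local isomorphism of manifolds. -/
def IsEtale {S T : An.{u}} (f : S ⟶ T) : Prop :=
  IsLocalDiffeomorph S.model T.model ω f.toFun

theorem Hom.continuous {S T : An.{u}} (f : S ⟶ T) : Continuous f.toFun :=
  f.analytic.continuous

@[simp] theorem id_apply (S : An.{u}) (x : S) : (𝟙 S : S ⟶ S).toFun x = x := rfl

@[simp] theorem comp_apply {S T R : An.{u}} (f : S ⟶ T) (g : T ⟶ R) (x : S) :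
    (f ≫ g).toFun x = g.toFun (f.toFun x) := rfl

theorem hom_ext {S T : An.{u}} {f g : S ⟶ T} (h : ∀ x, f.toFun x = g.toFun x) : f = g :=
  Hom.ext (funext h)

variable {M N P S T Z : An.{u}}

theorem IsEtale.isLocalHomeomorph {f : M ⟶ N} (hf : IsEtale f) : IsLocalHomeomorph f.toFun :=
  IsLocalDiffeomorph.isLocalHomeomorph hf

theorem IsEtale.comp {f : M ⟶ N} {g : N ⟶ P} (hf : IsEtale f) (hg : IsEtale g) :
    IsEtale (f ≫ g) := fun x => (hf x).comp _ _ (hg (f x))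

theorem IsEtale.of_comp {f : M ⟶ N} {g : N ⟶ P} (hgf : IsEtale (f ≫ g)) (hg : IsEtale g) :
    IsEtale f := fun x =>
  isLocalDiffeomorphAt_of_comp f.continuous.continuousAt (hgf x) (hg (f x))

/-- Near `t`, the map `h` is `f ∘ h` followed by the local inverse of `f` at `h t`. This reduces
analyticity of maps into a total space to continuity. -/
theorem IsEtale.analytic_lift {f : M ⟶ N} (hf : IsEtale f) {h : T → M} (hc : Continuous h)
    (ha : ContMDiff T.model N.model ω (f.toFun ∘ h)) : ContMDiff T.model M.model ω h := by
  intro t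
  have h1 := (hf (h t)).localInverse_contMDiffAt.comp t (ha t)
  refine h1.congr_of_eventuallyEq ?_
  filter_upwards [hc.continuousAt.eventually (hf (h t)).localInverse_eventuallyEq_left] with y hy
    using hy.symm

/-- Near `f x`, the map `k` is `k ∘ f` composed with a local inverse of `f`. Used for maps out of a
space that is covered by étale pieces. -/
theorem IsEtale.analyticAt_desc {f : M ⟶ N} (hf : IsEtale f) {k : N → Z} {x : M}
    (ha : ContMDiffAt M.model Z.model ω (k ∘ f.toFun) x) :
    ContMDiffAt N.model Z.model ω k (f x) := by
  have h0 := (hf x).localInverse_left_inv (hf x).localInverse_mem_target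
  have h1 : ContMDiffAt N.model Z.model ω ((k ∘ f.toFun) ∘ (hf x).localInverse) (f x) := by
    refine ContMDiffAt.comp (I' := M.model) (f x) ?_ (hf x).localInverse_contMDiffAt
    rw [h0]; exact ha
  refine h1.congr_of_eventuallyEq ?_
  filter_upwards [(hf x).localInverse_eventuallyEq_right] with y hy
  exact congrArg k hy.symm

theorem isEtale_of_isIso (f : M ⟶ N) [IsIso f] : IsEtale f := by
  refine Diffeomorph.isLocalDiffeomorph (I := M.model) (J := N.model)
    { toFun := f.toFun
      invFun := (inv f).toFun
      left_inv := fun x => congrFun (congrArg Hom.toFun (IsIso.hom_inv_id f)) x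
      right_inv := fun x => congrFun (congrArg Hom.toFun (IsIso.inv_hom_id f)) x
      contMDiff_toFun := f.analytic
      contMDiff_invFun := (inv f).analytic }

theorem IsEtale.isSubmersion {f : M ⟶ N} (hf : IsEtale f) : IsSubmersion f := by
  -- The derivative is invertible, so the complement in the normal form of a submersion is zero.
  refine ⟨PUnit, inferInstance, inferInstance, fun x => ?_⟩
  -- The two model spaces need not be literally the same, so the derivative serves as a linear
  -- identification. The source chart `d` below is `f`, then the chart `c`, then the inverse of `A`;
  -- in the charts `d` and `c`, `f` reads as `A`.
  have A := (hf x).mfderivToContinuousLinearEquiv (by simp)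
  let A : EuclideanSpace ℂ (Fin M.dim) ≃L[ℂ] EuclideanSpace ℂ (Fin N.dim) := A
  obtain ⟨Φ, hx, hΦ⟩ := hf x
  let c := chartAt (EuclideanSpace ℂ (Fin N.dim)) (f x)
  let d := (Φ.toOpenPartialHomeomorph.trans c).trans
    A.toHomeomorph.symm.toOpenPartialHomeomorph
  have hfx : f x = Φ x := hΦ hx
  refine Manifold.IsSubmersionAtOfComplement.mk_of_continuousAt f.continuous.continuousAt
    (A.trans (ContinuousLinearEquiv.prodUnique ℂ _ PUnit).symm) d c ?_ (mem_chart_source _ _) ?_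
    (IsManifold.chart_mem_maximalAtlas _) ?_
  · refine ⟨⟨hx, ?_⟩, trivial⟩
    change Φ x ∈ c.source
    rw [← hfx]; exact mem_chart_source _ _
  · apply OpenPartialHomeomorph.mem_maximalAtlas_of_contMDiffOn
    · refine A.symm.contDiff.contMDiff.comp_contMDiffOn (I' := N.model)
        ((contMDiffOn_of_mem_maximalAtlas (IsManifold.chart_mem_maximalAtlas (I := N.model) (f x))).comp
          (Φ.contMDiffOn_toFun.mono fun y hy => hy.1.1) fun y hy => hy.1.2)
    · refine Φ.contMDiffOn_invFun.comp (I' := N.model)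
        ((contMDiffOn_symm_of_mem_maximalAtlas
          (IsManifold.chart_mem_maximalAtlas (I := N.model) (f x))).comp (I' := N.model)
          (A.contDiff.contMDiff.contMDiffOn (s := d.target)) fun y hy => hy.2.1) fun y hy => hy.2.2
  · intro y hy
    have hy' : y ∈ d.target := by simpa using hy
    have h1 : Φ.symm (c.symm (A y)) ∈ Φ.source := Φ.map_target hy'.2.2
    change c (f (Φ.symm (c.symm (A y)))) = A y
    rw [show f (Φ.symm (c.symm (A y))) = Φ (Φ.symm (c.symm (A y))) from hΦ h1]
    exact (congrArg c (Φ.right_inv hy'.2.2)).trans (c.right_inv hy'.2.1)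

/-- In these charts `f` is the identity, so it agrees with `c` followed by the inverse of `c'`. This
covers open inclusions and projections of étale spaces. -/
theorem isLocalDiffeomorphAt_of_charts {E H M N : Type*} [NormedAddCommGroup E] [NormedSpace ℂ E]
    [TopologicalSpace H] {I : ModelWithCorners ℂ E H} [TopologicalSpace M] [ChartedSpace H M]
    [TopologicalSpace N] [ChartedSpace H N] [IsManifold I ω M] [IsManifold I ω N] {f : M → N}
    {x : M} {c : OpenPartialHomeomorph M H} {c' : OpenPartialHomeomorph N H}
    (hc : c ∈ IsManifold.maximalAtlas I ω M) (hc' : c' ∈ IsManifold.maximalAtlas I ω N)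
    (hx : x ∈ c.source) (h : ∀ y ∈ c.source, f y ∈ c'.source ∧ c y = c' (f y)) :
    IsLocalDiffeomorphAt I I ω f x := by
  let Φ : PartialDiffeomorph I I M H ω :=
    { c with
      contMDiffOn_toFun := contMDiffOn_of_mem_maximalAtlas hc
      contMDiffOn_invFun := contMDiffOn_symm_of_mem_maximalAtlas hc }
  let Φ' : PartialDiffeomorph I I N H ω :=
    { c' with
      contMDiffOn_toFun := contMDiffOn_of_mem_maximalAtlas hc'
      contMDiffOn_invFun := contMDiffOn_symm_of_mem_maximalAtlas hc' }
  refine ⟨Φ.trans Φ'.symm, ⟨hx, ?_⟩, fun y hy => ?_⟩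
  · change c x ∈ c'.target
    rw [(h x hx).2]
    exact c'.map_source (h x hx).1
  · change f y = c'.symm (c y)
    rw [(h y hy.1).2, c'.left_inv (h y hy.1).1]

theorem isEtale_incl (S : An.{u}) (U : Opens S) : IsEtale (S.incl U) := by
  rintro ⟨x, hx⟩
  let c := chartAt (EuclideanSpace ℂ (Fin S.dim)) x
  have hc : (chartAt (EuclideanSpace ℂ (Fin S.dim)) (⟨x, hx⟩ : U)) ∈
      IsManifold.maximalAtlas S.model ω U := IsManifold.chart_mem_maximalAtlas _
  refine isLocalDiffeomorphAt_of_charts (M := U) (N := S) (I := S.model) (f := Subtype.val)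
    hc (IsManifold.chart_mem_maximalAtlas x) (mem_chart_source _ _) fun y hy => ?_
  have hy' : y ∈ (c.subtypeRestr ⟨(⟨x, hx⟩ : U)⟩).source := hy
  rw [OpenPartialHomeomorph.subtypeRestr_source] at hy'
  exact ⟨hy', rfl⟩

/-! ### Complex structure on a space that is étale over a manifold. -/

section EtaleSpace

variable (S) (E : Type u) [TopologicalSpace E] [T2Space E] [SecondCountableTopology E]
  (π : E → S) (hπ : IsLocalHomeomorph π)

/-- The pull-back of a complex structure by a local homeomorphism. -/
noncomputable def etaleSpace : An.{u} :=
  letI charted : ChartedSpace (EuclideanSpace ℂ (Fin S.dim)) E :=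
    { atlas := Set.range fun q => (hπ q).choose.trans (chartAt (EuclideanSpace ℂ (Fin S.dim)) (π q))
      chartAt := fun q => (hπ q).choose.trans (chartAt (EuclideanSpace ℂ (Fin S.dim)) (π q))
      mem_chart_source := fun q => by
        obtain ⟨h1, h2⟩ := (hπ q).choose_spec
        refine ⟨h1, ?_⟩
        change (hπ q).choose q ∈ (chartAt (EuclideanSpace ℂ (Fin S.dim)) (π q)).source
        rw [← h2]
        exact mem_chart_source _ _
      chart_mem_atlas := fun q => ⟨q, rfl⟩ }
  { carrier := E
    dim := S.dim
    isManifold := by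
      have : HasGroupoid E (contDiffGroupoid ω S.model) := by
        constructor
        rintro _ _ ⟨q, rfl⟩ ⟨q', rfl⟩
        set e := (hπ q).choose
        set e' := (hπ q').choose
        have he : π = e := (hπ q).choose_spec.2
        have he' : π = e' := (hπ q').choose_spec.2
        set c := chartAt (EuclideanSpace ℂ (Fin S.dim)) (π q)
        set c' := chartAt (EuclideanSpace ℂ (Fin S.dim)) (π q')
        have hcc : c.symm.trans c' ∈ contDiffGroupoid ω S.model :=
          HasGroupoid.compatible (chart_mem_atlas _ _) (chart_mem_atlas _ _)
        set t := ((e.trans c).symm.trans (e'.trans c'))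
        -- As functions `e` and `e'` are both `π`, so they cancel in a change of charts. What
        -- remains is a restriction of the change of charts from `c` to `c'` on `S`.
        have key : ∀ y ∈ t.source, e' (e.symm (c.symm y)) = c.symm y := by
          intro y hy
          rw [← he', he, e.right_inv]
          exact hy.1.2
        have := StructureGroupoid.restr_mem_of_eqOn (e' := t) hcc t.open_source
          (fun y hy => congrArg c' (key y hy).symm) (fun y hy => ?_)
        · rwa [OpenPartialHomeomorph.restr_eq_of_source_subset subset_rfl] at this
        · refine ⟨hy.1.1.1, ?_⟩
          have := hy.1.2.2
          change e' (e.symm (c.symm y)) ∈ c'.source at this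
          rw [key y hy.1] at this
          exact this
      exact { } }

theorem isLocalDiffeomorph_etaleSpace :
    IsLocalDiffeomorph (M := etaleSpace S E π hπ) (etaleSpace S E π hπ).model S.model ω π := by
  intro (q : E)
  let : ChartedSpace (EuclideanSpace ℂ (Fin S.dim)) E := (etaleSpace S E π hπ).charted
  have : IsManifold S.model ω E := (etaleSpace S E π hπ).isManifold
  have hq := (hπ q).choose_spec
  refine isLocalDiffeomorphAt_of_charts (M := E) (N := S) (I := S.model) (f := π)
    (IsManifold.chart_mem_maximalAtlas q) (IsManifold.chart_mem_maximalAtlas (π q))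
    (mem_chart_source _ q) fun y hy => ?_
  have hy1 : (hπ q).choose y ∈ (chartAt (EuclideanSpace ℂ (Fin S.dim)) (π q)).source := hy.2
  have he := congrFun hq.2 y
  rw [← he] at hy1
  exact ⟨hy1, congrArg (chartAt (EuclideanSpace ℂ (Fin S.dim)) (π q)) he.symm⟩

/-- The projection of an étale space. -/
noncomputable def etaleProj : etaleSpace S E π hπ ⟶ S where
  toFun := π
  analytic := (isLocalDiffeomorph_etaleSpace S E π hπ).contMDiff

theorem isEtale_etaleProj : IsEtale (etaleProj S E π hπ) := isLocalDiffeomorph_etaleSpace S E π hπ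

end EtaleSpace
end An
end OrbiStack

/-! ### Local sections, group actions and principal bundles of a discrete group. -/

namespace OrbiStack

theorem isLocalHomeomorph_of_isOpenMap {A B : Type*} [TopologicalSpace A] [TopologicalSpace B]
    {f : A → B} (hc : Continuous f) (ho : IsOpenMap f) (hi : IsLocallyInjective f) :
    IsLocalHomeomorph f := by
  rw [isLocalHomeomorph_iff_isOpenEmbedding_restrict]
  intro x
  obtain ⟨W, hW, hx, hinj⟩ := hi x
  exact ⟨W, hW.mem_nhds hx, .of_continuous_injective_isOpenMap (hc.comp continuous_subtype_val)
    (Set.injOn_iff_injective.1 hinj) (ho.comp hW.isOpenMap_subtype_val)⟩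

namespace An

variable {M N S T : An.{u}}

/-- An étale map has local sections through every point. -/
theorem IsEtale.exists_section {f : M ⟶ N} (hf : IsEtale f) (x : M) :
    ∃ (V : Opens N) (σ : N.openSub V ⟶ M) (hx : f x ∈ V), σ ≫ f = N.incl V ∧
      σ.toFun (⟨f x, hx⟩ : V) = x := by
  let e := (hf x).localInverse
  let V : Opens N := ⟨e.source, e.open_source⟩
  refine ⟨V, ⟨fun y : V => e (y : N), ?_⟩, (hf x).localInverse_mem_source, ?_, ?_⟩
  · exact ContMDiffOn.comp_contMDiff (I' := N.model) (hf x).localInverse_contMDiffOn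
      (N.incl V).analytic fun y : V => y.2
  · exact hom_ext fun y : V => (hf x).localInverse_right_inv y.2
  · exact (hf x).localInverse_left_inv (hf x).localInverse_mem_target

theorem isEtale_section {f : M ⟶ N} (hf : IsEtale f) {V : Opens N} {σ : N.openSub V ⟶ M}
    (h : σ ≫ f = N.incl V) : IsEtale σ :=
  .of_comp (h ▸ isEtale_incl N V) hf

end An

namespace RightAction

variable {G : Type u} [Group G] {X : An.{u}} (ρ : RightAction G X)

@[simp] theorem act_one_apply (x : X) : (ρ.act 1).toFun x = x := by
  rw [ρ.act_one]; rfl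

theorem act_mul_apply (g h : G) (x : X) :
    (ρ.act (g * h)).toFun x = (ρ.act h).toFun ((ρ.act g).toFun x) := by
  rw [ρ.act_mul]; rfl

theorem isIso_act (g : G) : IsIso (ρ.act g) :=
  ⟨ρ.act g⁻¹, by rw [← ρ.act_mul, mul_inv_cancel, ρ.act_one],
    by rw [← ρ.act_mul, inv_mul_cancel, ρ.act_one]⟩

/-- An action by homeomorphisms over an étale map is analytic. -/
def ofContinuous {S : An.{u}} {π : X ⟶ S} (hπ : An.IsEtale π) (a : G → X → X)
    (hc : ∀ g, Continuous (a g)) (ha : ∀ g x, π.toFun (a g x) = π.toFun x)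
    (h1 : ∀ x, a 1 x = x) (hm : ∀ g h x, a (g * h) x = a h (a g x)) : RightAction G X where
  act g := ⟨a g, hπ.analytic_lift (hc g) (by
    rw [show π.toFun ∘ a g = π.toFun from funext (ha g)]; exact π.analytic)⟩
  act_one := An.hom_ext h1
  act_mul g h := An.hom_ext (hm g h)

end RightAction

namespace PrincipalBundle

variable {G : Type u} [Group G] {S T : An.{u}} (P : PrincipalBundle G S)

@[simp] theorem proj_act (g : G) (q : P.total) :
    P.proj.toFun ((P.action.act g).toFun q) = P.proj.toFun q :=
  congrFun (congrArg An.Hom.toFun (P.act_proj g)) q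

theorem proj_surjective : Function.Surjective P.proj.toFun := fun s => by
  obtain ⟨V, σ, hs, hσ, -⟩ := P.locally_trivial s
  exact ⟨σ.toFun (⟨s, hs⟩ : V), congrFun (congrArg An.Hom.toFun hσ) (⟨s, hs⟩ : V)⟩

/-- With a local section `σ`, both points are translates of the same value of `σ`, by `a` and `b`
say; the required element is `a⁻¹ * b`. -/
theorem existsUnique_act {q q' : P.total} (h : P.proj.toFun q = P.proj.toFun q') :
    ∃! g : G, (P.action.act g).toFun q = q' := by
  obtain ⟨V, σ, hs, hσ, -, hu⟩ := P.locally_trivial (P.proj q)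
  obtain ⟨a, ha, -⟩ := hu q hs
  obtain ⟨b, hb, hb'⟩ := hu q' (h ▸ hs)
  have hq : (P.action.act a).toFun (σ.toFun (⟨P.proj.toFun q', h ▸ hs⟩ : V)) = q := by
    simpa only [h] using ha
  refine ⟨a⁻¹ * b, ?_, fun g hg => ?_⟩
  · change (P.action.act (a⁻¹ * b)).toFun q = q'
    rw [← hq, ← RightAction.act_mul_apply, mul_inv_cancel_left]
    exact hb
  · rw [← hb' (a * g) ?_, inv_mul_cancel_left]
    change (P.action.act (a * g)).toFun _ = q'
    rw [RightAction.act_mul_apply, hq]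
    exact hg

theorem act_injective {q : P.total} {g h : G}
    (e : (P.action.act g).toFun q = (P.action.act h).toFun q) : g = h :=
  (P.existsUnique_act (P.proj_act h q).symm).unique e rfl

/-- A local section, translated so as to pass through `q`, is an analytic inverse of the projection
on its range. The range is open because sections are required to be open maps. -/
theorem isEtale_proj : An.IsEtale P.proj := by
  intro q
  obtain ⟨V, σ, hs, hσ, ho, hu⟩ := P.locally_trivial (P.proj q)
  obtain ⟨g, hg, -⟩ := hu q hs
  have hσ' : ∀ v : V, P.proj.toFun (σ.toFun v) = v := fun v =>
    congrFun (congrArg An.Hom.toFun hσ) v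
  let τ : S.openSub V ⟶ P.total := σ ≫ P.action.act g
  have hτ : ∀ v : V, P.proj.toFun (τ.toFun v) = v := fun v =>
    (P.proj_act g _).trans (hσ' v)
  have := P.action.isIso_act g
  have hτo : IsOpenMap τ.toFun :=
    (An.isEtale_of_isIso (P.action.act g)).isLocalHomeomorph.isOpenMap.comp ho
  classical
  let inv : S → P.total := fun s => if h : s ∈ V then τ.toFun (⟨s, h⟩ : V) else q
  have hinv : ∀ v : V, inv v = τ.toFun v := fun v => dif_pos v.2
  refine ⟨{ toFun := P.proj.toFun
            invFun := inv
            source := Set.range τ.toFun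
            target := V
            map_source' := ?_
            map_target' := ?_
            left_inv' := ?_
            right_inv' := ?_
            open_source := hτo.isOpen_range
            open_target := V.2
            contMDiffOn_toFun := P.proj.analytic.contMDiffOn
            contMDiffOn_invFun := ?_ }, ⟨(⟨P.proj q, hs⟩ : V), hg⟩, fun _ _ => rfl⟩
  · rintro _ ⟨v, rfl⟩
    rw [hτ v]; exact v.2
  · intro s hs
    exact ⟨(⟨s, hs⟩ : V), (hinv ⟨s, hs⟩).symm⟩
  · rintro _ ⟨v, rfl⟩
    rw [hτ v]; exact hinv v
  · intro s hs
    rw [hinv ⟨s, hs⟩, hτ]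
  · intro s hs
    refine ((An.isEtale_incl S V).analyticAt_desc (x := (⟨s, hs⟩ : V)) ?_).contMDiffWithinAt
    rw [show inv ∘ (S.incl V).toFun = τ.toFun from funext hinv]
    exact τ.analytic _

/-- A free action which is simply transitive on the fibres of a surjective étale map defines a
principal bundle. -/
def ofEtale {E : An.{u}} (π : E ⟶ S) (a : RightAction G E) (ha : ∀ g, a.act g ≫ π = π)
    (hπ : An.IsEtale π) (hs : Function.Surjective π.toFun)
    (hu : ∀ q q' : E, π.toFun q = π.toFun q' → ∃! g : G, (a.act g).toFun q = q') :
    PrincipalBundle G S where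
  total := E
  proj := π
  action := a
  act_proj := ha
  locally_trivial s := by
    obtain ⟨q, rfl⟩ := hs s
    obtain ⟨V, σ, hq, hσ, -⟩ := hπ.exists_section q
    refine ⟨V, σ, hq, hσ, (An.isEtale_section hπ hσ).isLocalHomeomorph.isOpenMap, fun q' hq' => ?_⟩
    exact hu _ _ (congrFun (congrArg An.Hom.toFun hσ) (⟨_, hq'⟩ : V))

/-- The projection is locally injective, so two continuous lifts of the same map agree on an open
set. -/
theorem eventuallyEq_of_proj {A : Type*} [TopologicalSpace A] {a b : A → P.total}
    (ha : Continuous a) (hb : Continuous b)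
    (h : ∀ t, P.proj.toFun (a t) = P.proj.toFun (b t)) {t : A} (ht : a t = b t) :
    ∀ᶠ t' in nhds t, a t' = b t' :=
  (P.isEtale_proj.isLocalHomeomorph.isLocallyInjective.isOpen_eqLocus ha hb (funext h)).mem_nhds ht

theorem exists_section (q : P.total) :
    ∃ (V : Opens S) (σ : S.openSub V ⟶ P.total) (hx : P.proj.toFun q ∈ V), σ ≫ P.proj = S.incl V ∧
      σ.toFun (⟨P.proj.toFun q, hx⟩ : V) = q :=
  P.isEtale_proj.exists_section q

end PrincipalBundle

end OrbiStack

/-! ### Morphisms of bundles and their cartesian property. -/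

namespace OrbiStack

namespace QuotientHom

variable {G : Type u} [Group G] {X : An.{u}} {ρ : RightAction G X} {P Q R : QuotientObj ρ}

@[simp] theorem proj_total (φ : QuotientHom P Q) (p : P.bundle.total) :
    Q.bundle.proj.toFun (φ.total.toFun p) = φ.base.toFun (P.bundle.proj.toFun p) :=
  congrFun (congrArg An.Hom.toFun φ.comm) p

theorem total_act (φ : QuotientHom P Q) (g : G) (p : P.bundle.total) :
    φ.total.toFun ((P.bundle.action.act g).toFun p) =
      (Q.bundle.action.act g).toFun (φ.total.toFun p) :=
  congrFun (congrArg An.Hom.toFun (φ.equivariant g)) p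

@[simp] theorem toX_total (φ : QuotientHom P Q) (p : P.bundle.total) :
    Q.toX.toFun (φ.total.toFun p) = P.toX.toFun p :=
  congrFun (congrArg An.Hom.toFun φ.toX) p

theorem base_eq_of_total_eq {φ ψ : QuotientHom P Q} (h : φ.total = ψ.total) : φ.base = ψ.base := by
  refine An.hom_ext fun s => ?_
  obtain ⟨p, rfl⟩ := P.bundle.proj_surjective s
  rw [← proj_total, ← proj_total, h]

theorem ext_total {φ ψ : QuotientHom P Q}
    (h : ∀ p, φ.total.toFun p = ψ.total.toFun p) : φ = ψ :=
  have h' : φ.total = ψ.total := An.hom_ext h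
  QuotientHom.ext (base_eq_of_total_eq h') h'

/-- A morphism of bundles is bijective on fibres. -/
theorem existsUnique_fibre (φ : QuotientHom P Q) {b : P.base} {q : Q.bundle.total}
    (h : Q.bundle.proj.toFun q = φ.base.toFun b) :
    ∃! p, P.bundle.proj.toFun p = b ∧ φ.total.toFun p = q := by
  obtain ⟨p, rfl⟩ := P.bundle.proj_surjective b
  obtain ⟨g, hg, -⟩ := Q.bundle.existsUnique_act (q := φ.total.toFun p) (q' := q) (by simp [h])
  refine ⟨(P.bundle.action.act g).toFun p, ⟨by simp, by rw [total_act, hg]⟩, ?_⟩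
  rintro p' ⟨h1, h2⟩
  obtain ⟨g', rfl, -⟩ := P.bundle.existsUnique_act h1.symm
  rw [total_act, ← hg] at h2
  rw [Q.bundle.act_injective h2]

theorem total_injective_on_fibre (φ : QuotientHom P Q) {p p' : P.bundle.total}
    (h : P.bundle.proj.toFun p = P.bundle.proj.toFun p')
    (h' : φ.total.toFun p = φ.total.toFun p') : p = p' :=
  (φ.existsUnique_fibre (q := φ.total.toFun p') (φ.proj_total p')).unique ⟨h, h'⟩ ⟨rfl, rfl⟩

/-- A map to the total space of a bundle is continuous if it is so after projection to the base
and after composition with a morphism of bundles. -/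
theorem continuous_of_total (φ : QuotientHom P Q) {A : Type*} [TopologicalSpace A]
    {k : A → P.bundle.total} (h1 : Continuous (P.bundle.proj.toFun ∘ k))
    (h2 : Continuous (φ.total.toFun ∘ k)) : Continuous k := by
  rw [continuous_iff_continuousAt]
  intro t
  obtain ⟨V, σ, hV, hσ, hσt⟩ := P.bundle.exists_section (k t)
  have hσ' : ∀ v : V, P.bundle.proj.toFun (σ.toFun v) = v := fun v =>
    congrFun (congrArg An.Hom.toFun hσ) v
  let B : Set A := (P.bundle.proj.toFun ∘ k) ⁻¹' V
  have hB : IsOpen B := V.2.preimage h1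
  let j : B → V := fun b => ⟨P.bundle.proj.toFun (k b), b.2⟩
  have hj : Continuous j := (h1.comp continuous_subtype_val).subtype_mk _
  have hσj : Continuous fun b : B => σ.toFun (j b) := σ.continuous.comp hj
  -- After `φ`, the maps `k` and `σ ∘ j` are continuous lifts of the same map and agree at `t`,
  -- hence near `t`. Injectivity of `φ` on fibres then gives `k = σ ∘ j` near `t`, and the right
  -- side is continuous.
  have key := Q.bundle.eventuallyEq_of_proj (t := (⟨t, hV⟩ : B))
    (h2.comp continuous_subtype_val) (φ.total.continuous.comp hσj)
    (fun b => by simp [hσ', j]) (congrArg φ.total.toFun hσt.symm)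
  have hc : ContinuousAt (fun b : B => k b) ⟨t, hV⟩ := by
    refine hσj.continuousAt.congr ?_
    filter_upwards [key] with b hb
    exact (φ.total_injective_on_fibre (by simp [hσ', j]) hb).symm
  exact (hB.isOpenEmbedding_subtypeVal.continuousAt_iff (x := ⟨t, hV⟩)).1 hc

/-- A continuous morphism of bundles is analytic. -/
def ofContinuous (f : P.base ⟶ Q.base) (k : P.bundle.total → Q.bundle.total) (hk : Continuous k)
    (hp : ∀ p, Q.bundle.proj.toFun (k p) = f.toFun (P.bundle.proj.toFun p))
    (ha : ∀ g p, k ((P.bundle.action.act g).toFun p) = (Q.bundle.action.act g).toFun (k p))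
    (hX : ∀ p, Q.toX.toFun (k p) = P.toX.toFun p) : QuotientHom P Q where
  base := f
  total := ⟨k, Q.bundle.isEtale_proj.analytic_lift hk (by
    rw [show Q.bundle.proj.toFun ∘ k = (P.bundle.proj ≫ f).toFun from funext hp]
    exact (P.bundle.proj ≫ f).analytic)⟩
  comm := An.hom_ext hp
  equivariant g := An.hom_ext (ha g)
  toX := An.hom_ext hX

theorem isEtale_total (φ : QuotientHom P Q) (h : An.IsEtale φ.base) : An.IsEtale φ.total :=
  .of_comp (φ.comm ▸ P.bundle.isEtale_proj.comp h) Q.bundle.isEtale_proj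

/-- Every morphism of bundles is cartesian. -/
theorem existsUnique_lift (φ : QuotientHom Q R) (ψ : QuotientHom P R) (h : P.base ⟶ Q.base)
    (e : h ≫ φ.base = ψ.base) :
    ∃! χ : QuotientHom P Q, χ.base = h ∧ χ.total ≫ φ.total = ψ.total := by
  have e' : ∀ s, φ.base.toFun (h.toFun s) = ψ.base.toFun s := fun s =>
    congrFun (congrArg An.Hom.toFun e) s
  -- The value of the lift at each point is forced, as `φ` is bijective on fibres. Continuity
  -- follows because both the projection of the lift and its composition with `φ` are known maps.
  have hex : ∀ p : P.bundle.total, ∃ q, Q.bundle.proj.toFun q = h.toFun (P.bundle.proj.toFun p) ∧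
      φ.total.toFun q = ψ.total.toFun p := fun p =>
    (φ.existsUnique_fibre (by simp [e'])).exists
  choose k hk1 hk2 using hex
  have hk : Continuous k := by
    refine φ.continuous_of_total ?_ ?_
    · rw [show Q.bundle.proj.toFun ∘ k = (P.bundle.proj ≫ h).toFun from funext hk1]
      exact An.Hom.continuous _
    · rw [show φ.total.toFun ∘ k = ψ.total.toFun from funext hk2]
      exact An.Hom.continuous _
  refine ⟨ofContinuous h k hk hk1 (fun g p => ?_) (fun p => ?_), ⟨rfl, An.hom_ext hk2⟩, ?_⟩
  · refine φ.total_injective_on_fibre (by simp [hk1]) ?_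
    rw [hk2, total_act, total_act, hk2]
  · rw [← φ.toX_total, hk2, ψ.toX_total]
  · rintro χ ⟨h1, h2⟩
    refine ext_total fun p => φ.total_injective_on_fibre ?_ ?_
    · rw [proj_total, h1]; exact (hk1 p).symm
    · exact (congrFun (congrArg An.Hom.toFun h2) p).trans (hk2 p).symm

theorem exists_lift (φ : QuotientHom Q R) (ψ : QuotientHom P R) (h : P.base ⟶ Q.base)
    (e : h ≫ φ.base = ψ.base) :
    ∃ χ : QuotientHom P Q, χ.base = h ∧ ∀ p, φ.total.toFun (χ.total.toFun p) = ψ.total.toFun p :=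
  let ⟨χ, h1, _⟩ := φ.existsUnique_lift ψ h e
  ⟨χ, h1.1, fun p => congrFun (congrArg An.Hom.toFun h1.2) p⟩

/-- Lifting the identity of `Q` along `φ` gives a one-sided inverse; injectivity of `φ` on fibres
makes it two-sided. -/
theorem isIso_of_base (φ : P ⟶ Q) (h : IsIso (QuotientHom.base φ)) : IsIso φ := by
  obtain ⟨χ, h1, h2⟩ := exists_lift φ (𝟙 Q : Q ⟶ Q) (inv (QuotientHom.base φ)) (by
    rw [IsIso.inv_hom_id]; rfl)
  refine ⟨χ, ext_total fun p => φ.total_injective_on_fibre ?_ (h2 _), ext_total h2⟩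
  change P.bundle.proj.toFun (χ.total.toFun (φ.total.toFun p)) = P.bundle.proj.toFun p
  rw [proj_total, proj_total, h1]
  exact congrFun (congrArg An.Hom.toFun (IsIso.hom_inv_id (QuotientHom.base φ))) _

end QuotientHom

/-! ### Pull-back of bundles. -/

section Pullback

variable {G : Type u} [Group G] {S T : An.{u}}

/-- The total space of the pull-back of a bundle. -/
abbrev PullbackSpace (P : PrincipalBundle G S) (f : T ⟶ S) : Type u :=
  {x : T × P.total // f.toFun x.1 = P.proj.toFun x.2}

instance (P : PrincipalBundle G S) (f : T ⟶ S) : SecondCountableTopology (PullbackSpace P f) :=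
  Topology.IsEmbedding.subtypeVal.secondCountableTopology

/-- Base change of the local homeomorphism `P.proj`: openness lifts nearby points of `S` to nearby
points of `P`, and two points over the same `t` have second components in the same fibre of `P`,
where `P.proj` is locally injective. -/
theorem isLocalHomeomorph_pullback (P : PrincipalBundle G S) (f : T ⟶ S) :
    IsLocalHomeomorph fun x : PullbackSpace P f => x.1.1 := by
  have hP := P.isEtale_proj.isLocalHomeomorph
  refine isLocalHomeomorph_of_isOpenMap (by fun_prop) ?_ ?_
  · refine IsOpenMap.of_nhds_le ?_
    rintro ⟨⟨t, q⟩, h⟩ W hW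
    obtain ⟨W', hW', hsub⟩ := mem_nhds_subtype _ _ _ |>.1 (Filter.mem_map.1 hW)
    obtain ⟨A, hA, B, hB, hAB⟩ := mem_nhds_prod_iff.1 hW'
    have h1 : P.proj.toFun '' B ∈ nhds (f.toFun t) := by
      rw [show f.toFun t = P.proj.toFun q from h]
      exact hP.isOpenMap.image_mem_nhds hB
    filter_upwards [hA, f.continuous.continuousAt.preimage_mem_nhds h1] with t' h2 h3
    obtain ⟨q', hq', e⟩ := h3
    exact hsub (show (⟨(t', q'), e.symm⟩ : PullbackSpace P f) ∈ _ from hAB ⟨h2, hq'⟩)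
  · rintro ⟨⟨t, q⟩, h⟩
    obtain ⟨W, hW, hq, hinj⟩ := hP.isLocallyInjective q
    refine ⟨(fun x : PullbackSpace P f => x.1.2) ⁻¹' W, hW.preimage (by fun_prop), hq, ?_⟩
    rintro ⟨⟨t, q⟩, h⟩ hx ⟨⟨t', q'⟩, h'⟩ hx' (rfl : t = t')
    have : q = q' := hinj hx hx' (h.symm.trans h')
    subst this; rfl

/-- The action on the total space of the pull-back of a bundle. -/
def pullbackAct (P : PrincipalBundle G S) (f : T ⟶ S) (g : G) (x : PullbackSpace P f) :
    PullbackSpace P f :=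
  ⟨(x.1.1, (P.action.act g).toFun x.1.2), by rw [P.proj_act]; exact x.2⟩

theorem continuous_pullbackAct (P : PrincipalBundle G S) (f : T ⟶ S) (g : G) :
    Continuous (pullbackAct P f g) :=
  Continuous.subtype_mk (continuous_subtype_val.fst.prodMk
    ((P.action.act g).continuous.comp continuous_subtype_val.snd)) _

/-- The pull-back of a principal bundle. -/
noncomputable def PrincipalBundle.pullback (P : PrincipalBundle G S) (f : T ⟶ S) :
    PrincipalBundle G T :=
  have hπ := An.isEtale_etaleProj T (PullbackSpace P f) _ (isLocalHomeomorph_pullback P f)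
  .ofEtale (An.etaleProj T (PullbackSpace P f) _ (isLocalHomeomorph_pullback P f))
    (.ofContinuous hπ
      (pullbackAct P f) (continuous_pullbackAct P f)
      (fun _ _ => rfl)
      (fun x => Subtype.ext (Prod.ext rfl (P.action.act_one_apply _)))
      (fun g h x => Subtype.ext (Prod.ext rfl (P.action.act_mul_apply g h _))))
    (fun _ => rfl) hπ
    (fun t => let ⟨q, hq⟩ := P.proj_surjective (f.toFun t)
      ⟨(⟨(t, q), hq.symm⟩ : PullbackSpace P f), rfl⟩)
    (by
      rintro ⟨⟨t, q⟩, h⟩ ⟨⟨t', q'⟩, h'⟩ (rfl : t = t')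
      obtain ⟨g, hg, hu⟩ := P.existsUnique_act (h.symm.trans h')
      refine ⟨g, Subtype.ext (Prod.ext rfl hg), fun g' hg' => hu g' ?_⟩
      exact congrArg (fun x : PullbackSpace P f => x.1.2) hg')

/-- The projection from the pull-back of a bundle to the bundle. -/
noncomputable def PrincipalBundle.pullbackSnd (P : PrincipalBundle G S) (f : T ⟶ S) :
    (P.pullback f).total ⟶ P.total :=
  ⟨fun x : PullbackSpace P f => x.1.2, P.isEtale_proj.analytic_lift
    (show Continuous fun x : PullbackSpace P f => x.1.2 from continuous_subtype_val.snd)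
    (((P.pullback f).proj ≫ f).analytic.congr fun x : PullbackSpace P f => x.2.symm)⟩

variable {X : An.{u}} {ρ : RightAction G X}

/-- The pull-back of an object of the quotient stack. -/
noncomputable def QuotientObj.pullback (Q : QuotientObj ρ) (f : T ⟶ Q.base) : QuotientObj ρ where
  base := T
  bundle := Q.bundle.pullback f
  toX := Q.bundle.pullbackSnd f ≫ Q.toX
  equivariant g := by
    refine An.hom_ext fun x : PullbackSpace Q.bundle f => ?_
    exact congrFun (congrArg An.Hom.toFun (Q.equivariant g)) x.1.2

/-- The canonical morphism from a pull-back. -/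
noncomputable def QuotientObj.pullbackHom (Q : QuotientObj ρ) (f : T ⟶ Q.base) :
    Q.pullback f ⟶ Q :=
  show QuotientHom (Q.pullback f) Q from
  { base := f
    total := Q.bundle.pullbackSnd f
    comm := An.hom_ext fun x : PullbackSpace Q.bundle f => x.2.symm
    equivariant := fun _ => rfl
    toX := rfl }

end Pullback

end OrbiStack

/-! ### `[X/G]` as a category fibred in groupoids, and descent of morphisms. -/

namespace OrbiStack

open CategoryTheory.Functor

section

variable {G : Type u} [Group G] {X : An.{u}} {ρ : RightAction G X}

instance isStronglyCartesian_quotientStack {R S : An.{u}} {a b : (quotientStack ρ).obj} (f : R ⟶ S)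
    (φ : a ⟶ b) [(quotientStack ρ).p.IsHomLift f φ] :
    (quotientStack ρ).p.IsStronglyCartesian f φ := by
  subst_hom_lift (quotientStack ρ).p f φ
  refine { universal_property' := ?_ }
  intro c g ψ hψ
  have e : g ≫ QuotientHom.base φ = QuotientHom.base ψ :=
    @IsHomLift.eq_of_isHomLift _ _ _ _ (quotientStack ρ).p _ _ _ ψ hψ
  obtain ⟨χ, ⟨h1, h2⟩, h3⟩ := QuotientHom.existsUnique_lift φ ψ g e
  refine ⟨χ, ⟨?_, QuotientHom.ext (by rw [← e, ← h1]; rfl) h2⟩, fun χ' h' => h3 χ' ⟨?_, ?_⟩⟩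
  · rw [← h1]
    exact IsHomLift.map (quotientStack ρ).p χ
  · have := h'.1
    exact (IsHomLift.eq_of_isHomLift (quotientStack ρ).p g χ').symm
  · exact congrArg QuotientHom.total h'.2

instance isFibered_quotientStack : (quotientStack ρ).p.IsFibered :=
  .of_exists_isStronglyCartesian fun a _ f =>
    have : (quotientStack ρ).p.IsHomLift f (QuotientObj.pullbackHom a f) :=
      IsHomLift.map (quotientStack ρ).p (QuotientObj.pullbackHom a f)
    ⟨QuotientObj.pullback a f, QuotientObj.pullbackHom a f, isStronglyCartesian_quotientStack _ _⟩

theorem isIso_of_isHomLift_id {S : An.{u}} {a b : (quotientStack ρ).obj} (φ : a ⟶ b)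
    [(quotientStack ρ).p.IsHomLift (𝟙 S) φ] : IsIso φ := by
  refine QuotientHom.isIso_of_base φ ?_
  have h : IsIso ((quotientStack ρ).p.map φ) := by
    rw [IsHomLift.fac' (quotientStack ρ).p (𝟙 S) φ]
    infer_instance
  exact h

/-- The projection of an object over `S` to `S`. -/
def projTo {S : An.{u}} {a : (quotientStack ρ).obj} (h : (quotientStack ρ).p.obj a = S) :
    (QuotientObj.bundle a).total ⟶ S :=
  (QuotientObj.bundle a).proj ≫ eqToHom h

/-- The map of total spaces of a morphism. -/
abbrev totalMap {a b : (quotientStack ρ).obj} (φ : a ⟶ b) :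
    (QuotientObj.bundle a).total → (QuotientObj.bundle b).total :=
  (QuotientHom.total φ).toFun

/-- The base of an object over `S` is only propositionally equal to `S`. This and the following
statements carry facts about bundles across that equality. -/
theorem isEtale_projTo {S : An.{u}} {a : (quotientStack ρ).obj}
    (h : (quotientStack ρ).p.obj a = S) : An.IsEtale (projTo h) := by
  subst h
  exact PrincipalBundle.isEtale_proj _

theorem projTo_act {S : An.{u}} {a : (quotientStack ρ).obj} (h : (quotientStack ρ).p.obj a = S)
    (g : G) (q : (QuotientObj.bundle a).total) :
    (projTo h).toFun (((QuotientObj.bundle a).action.act g).toFun q) = (projTo h).toFun q :=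
  congrArg (eqToHom h).toFun (PrincipalBundle.proj_act _ g q)

theorem projTo_surjective {S : An.{u}} {a : (quotientStack ρ).obj}
    (h : (quotientStack ρ).p.obj a = S) : Function.Surjective (projTo h).toFun := by
  subst h
  exact PrincipalBundle.proj_surjective _

theorem existsUnique_act_of_projTo {S : An.{u}} {a : (quotientStack ρ).obj}
    (h : (quotientStack ρ).p.obj a = S) {q q' : (QuotientObj.bundle a).total}
    (e : (projTo h).toFun q = (projTo h).toFun q') :
    ∃! g, ((QuotientObj.bundle a).action.act g).toFun q = q' := by
  subst h
  exact PrincipalBundle.existsUnique_act _ e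

theorem projTo_totalMap {R S : An.{u}} {a b : (quotientStack ρ).obj} (f : R ⟶ S) (φ : a ⟶ b)
    [(quotientStack ρ).p.IsHomLift f φ] (ha : (quotientStack ρ).p.obj a = R)
    (hb : (quotientStack ρ).p.obj b = S) (q : (QuotientObj.bundle a).total) :
    (projTo hb).toFun (totalMap φ q) = f.toFun ((projTo ha).toFun q) := by
  subst_hom_lift (quotientStack ρ).p f φ
  exact QuotientHom.proj_total φ q

theorem exists_totalMap_eq {R S : An.{u}} {a b : (quotientStack ρ).obj} (f : R ⟶ S) (φ : a ⟶ b)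
    [(quotientStack ρ).p.IsHomLift f φ] (ha : (quotientStack ρ).p.obj a = R)
    (hb : (quotientStack ρ).p.obj b = S) {q : (QuotientObj.bundle b).total} {t : R}
    (h : f.toFun t = (projTo hb).toFun q) : ∃ p, (projTo ha).toFun p = t ∧ totalMap φ p = q := by
  subst_hom_lift (quotientStack ρ).p f φ
  exact (QuotientHom.existsUnique_fibre φ h.symm).exists

theorem totalMap_injective_on_fibre {S : An.{u}} {a b : (quotientStack ρ).obj} (φ : a ⟶ b)
    (ha : (quotientStack ρ).p.obj a = S) {p p' : (QuotientObj.bundle a).total}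
    (h : (projTo ha).toFun p = (projTo ha).toFun p') (h' : totalMap φ p = totalMap φ p') :
    p = p' := by
  subst ha
  exact QuotientHom.total_injective_on_fibre φ h h'

theorem isEtale_total_of_isHomLift {R S : An.{u}} {a b : (quotientStack ρ).obj} {f : R ⟶ S}
    (hf : An.IsEtale f) (φ : a ⟶ b) [(quotientStack ρ).p.IsHomLift f φ] :
    An.IsEtale (QuotientHom.total φ) := by
  subst_hom_lift (quotientStack ρ).p f φ
  exact QuotientHom.isEtale_total φ hf

theorem totalMap_injective {R S : An.{u}} {a b : (quotientStack ρ).obj} {f : R ⟶ S}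
    (hf : Function.Injective f.toFun) (φ : a ⟶ b) [(quotientStack ρ).p.IsHomLift f φ] :
    Function.Injective (totalMap φ) := by
  intro p p' h
  have ha := IsHomLift.domain_eq (quotientStack ρ).p f φ
  have hb := IsHomLift.codomain_eq (quotientStack ρ).p f φ
  refine totalMap_injective_on_fibre φ ha (hf ?_) h
  rw [← projTo_totalMap f φ ha hb, ← projTo_totalMap f φ ha hb, h]

/-- Continuous equivariant maps of bundles over a given morphism of manifolds are morphisms of the
quotient stack. -/
theorem exists_hom_of_continuous {R S : An.{u}} {a b : (quotientStack ρ).obj} (f : R ⟶ S)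
    (ha : (quotientStack ρ).p.obj a = R) (hb : (quotientStack ρ).p.obj b = S)
    (k : (QuotientObj.bundle a).total → (QuotientObj.bundle b).total) (hk : Continuous k)
    (hp : ∀ p, (projTo hb).toFun (k p) = f.toFun ((projTo ha).toFun p))
    (hact : ∀ g p, k (((QuotientObj.bundle a).action.act g).toFun p) =
      ((QuotientObj.bundle b).action.act g).toFun (k p))
    (hX : ∀ p, (QuotientObj.toX b).toFun (k p) = (QuotientObj.toX a).toFun p) :
    ∃ φ : a ⟶ b, (quotientStack ρ).p.IsHomLift f φ ∧ totalMap φ = k := by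
  subst ha hb
  exact ⟨QuotientHom.ofContinuous f k hk hp hact hX,
    CategoryTheory.IsHomLift.map (quotientStack ρ).p (QuotientHom.ofContinuous f k hk hp hact hX),
    rfl⟩

theorem hom_ext_totalMap {a b : (quotientStack ρ).obj} {φ ψ : a ⟶ b}
    (h : ∀ q, totalMap φ q = totalMap ψ q) : φ = ψ :=
  QuotientHom.ext_total h

theorem totalMap_act {a b : (quotientStack ρ).obj} (φ : a ⟶ b) (g : G)
    (q : (QuotientObj.bundle a).total) :
    totalMap φ (((QuotientObj.bundle a).action.act g).toFun q) =
      ((QuotientObj.bundle b).action.act g).toFun (totalMap φ q) :=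
  QuotientHom.total_act φ g q

theorem toX_totalMap {a b : (quotientStack ρ).obj} (φ : a ⟶ b)
    (q : (QuotientObj.bundle a).total) :
    (QuotientObj.toX b).toFun (totalMap φ q) = (QuotientObj.toX a).toFun q :=
  QuotientHom.toX_total φ q

/-- Restrictions of bundles to the members of an open covering glue along their overlaps: two
points with the same image come from a point over the overlap. -/
theorem exists_overlap {S : An.{u}} {V W : Opens S} {a b d : (quotientStack ρ).obj}
    (α : a ⟶ d) (β : b ⟶ d) [(quotientStack ρ).p.IsHomLift (S.incl V) α]
    [(quotientStack ρ).p.IsHomLift (S.incl W) β] :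
    ∃ (c : (quotientStack ρ).obj) (l : c ⟶ a) (r : c ⟶ b),
      (quotientStack ρ).p.IsHomLift (S.inclOfLE (inf_le_left : V ⊓ W ≤ V)) l ∧
      (quotientStack ρ).p.IsHomLift (S.inclOfLE (inf_le_right : V ⊓ W ≤ W)) r ∧
      l ≫ α = r ≫ β ∧ ∀ p q, totalMap α p = totalMap β q → ∃ z, totalMap l z = p ∧
        totalMap r z = q := by
  have ha := IsHomLift.domain_eq (quotientStack ρ).p (S.incl V) α
  have hb := IsHomLift.domain_eq (quotientStack ρ).p (S.incl W) β
  have hd := IsHomLift.codomain_eq (quotientStack ρ).p (S.incl V) α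
  let l := IsPreFibered.pullbackMap ha (S.inclOfLE (inf_le_left : V ⊓ W ≤ V))
  have hc := IsHomLift.domain_eq (quotientStack ρ).p (S.inclOfLE (inf_le_left : V ⊓ W ≤ V)) l
  have e : S.inclOfLE (inf_le_left : V ⊓ W ≤ V) ≫ S.incl V =
    S.inclOfLE (inf_le_right : V ⊓ W ≤ W) ≫ S.incl W := rfl
  -- The overlap is the restriction of `a`; since `β` is cartesian, the overlap maps to `b` as well.
  let r := IsStronglyCartesian.map (quotientStack ρ).p (S.incl W) β e (l ≫ α)
  have hr : r ≫ β = l ≫ α := IsStronglyCartesian.fac ..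
  refine ⟨_, l, r, inferInstance, inferInstance, hr.symm, fun p q h => ?_⟩
  have h1 := projTo_totalMap (S.incl V) α ha hd p
  have h2 := projTo_totalMap (S.incl W) β hb hd q
  have hs : (S.incl V).toFun ((projTo ha).toFun p) ∈ V ⊓ W := by
    refine ⟨Subtype.property (p := fun s => s ∈ V) _, ?_⟩
    rw [← h1, h, h2]
    exact Subtype.property (p := fun s => s ∈ W) _
  obtain ⟨z, -, hz⟩ := exists_totalMap_eq (S.inclOfLE (inf_le_left : V ⊓ W ≤ V)) l hc ha
    (q := p) (t := (⟨_, hs⟩ : (V ⊓ W : Opens S))) rfl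
  -- `z` was chosen over `p` only. It also lies over `q`, because `β` covers an injective map and is
  -- therefore injective on total spaces.
  refine ⟨z, hz, totalMap_injective (f := S.incl W) Subtype.val_injective β ?_⟩
  rw [← h, ← hz]
  exact congrArg (fun m => totalMap m z) hr

/-- The images of the `α i` cover the total space of `a`, and two preimages of one point come from
an overlap, where the `φ i` agree. So the glued map is defined pointwise; its continuity can be
checked after composition with the étale maps `α i`. -/
theorem glue_hom_quotientStack (S : An.{u}) (ι : Type u) (U : ι → Opens S) (hU : ⨆ i, U i = ⊤)
    (a b : (quotientStack ρ).obj) (ha : (quotientStack ρ).p.obj a = S)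
    (hb : (quotientStack ρ).p.obj b = S) (a' : ι → (quotientStack ρ).obj)
    (α : ∀ i, a' i ⟶ a) (φ : ∀ i, a' i ⟶ b)
    (hα : ∀ i, (quotientStack ρ).p.IsHomLift (S.incl (U i)) (α i))
    (hφ : ∀ i, (quotientStack ρ).p.IsHomLift (S.incl (U i)) (φ i))
    (hc : ∀ (i j : ι) (c : (quotientStack ρ).obj) (l : c ⟶ a' i) (r : c ⟶ a' j),
        (quotientStack ρ).p.IsHomLift (S.inclOfLE (inf_le_left : U i ⊓ U j ≤ U i)) l →
        (quotientStack ρ).p.IsHomLift (S.inclOfLE (inf_le_right : U i ⊓ U j ≤ U j)) r →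
        l ≫ α i = r ≫ α j → l ≫ φ i = r ≫ φ j) :
    ∃! ψ : a ⟶ b, (quotientStack ρ).p.IsHomLift (𝟙 S) ψ ∧ ∀ i, α i ≫ ψ = φ i := by
  have ha' := fun i => IsHomLift.domain_eq (quotientStack ρ).p (S.incl (U i)) (α i)
  have hsurj : ∀ q, ∃ i p, totalMap (α i) p = q := fun q => by
    have hq : (projTo ha).toFun q ∈ ⨆ i, U i := hU ▸ trivial
    obtain ⟨i, hi⟩ := Opens.mem_iSup.1 hq
    obtain ⟨p, -, hp⟩ := exists_totalMap_eq (S.incl (U i)) (α i) (ha' i) ha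
      (q := q) (t := (⟨_, hi⟩ : U i)) rfl
    exact ⟨i, p, hp⟩
  have hcompat : ∀ i j p q, totalMap (α i) p = totalMap (α j) q →
      totalMap (φ i) p = totalMap (φ j) q := fun i j p q h => by
    obtain ⟨c, l, r, hl, hr, e, hz⟩ := exists_overlap (V := U i) (W := U j) (α i) (α j)
    obtain ⟨z, rfl, rfl⟩ := hz p q h
    exact congrArg (fun m => totalMap m z) (hc i j c l r hl hr e)
  choose i p hp using hsurj
  let k := fun q => totalMap (φ (i q)) (p q)
  have hk : ∀ j x, k (totalMap (α j) x) = totalMap (φ j) x := fun j x => hcompat _ _ _ _ (hp _)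
  have hkc : Continuous k := by
    rw [continuous_iff_continuousAt]
    intro q
    rw [← hp q]
    refine ((isEtale_total_of_isHomLift (An.isEtale_incl S (U (i q))) (α (i q))).analyticAt_desc
      (Z := (QuotientObj.bundle b).total) ?_).continuousAt
    rw [show k ∘ (QuotientHom.total (α (i q))).toFun = _ from funext (hk (i q))]
    exact (QuotientHom.total (φ (i q))).analytic _
  have h1 : ∀ q, (projTo hb).toFun (k q) = (𝟙 S : S ⟶ S).toFun ((projTo ha).toFun q) := fun q => by
    rw [← hp q, hk, projTo_totalMap (S.incl (U (i q))) (φ (i q)) (ha' _) hb,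
      projTo_totalMap (S.incl (U (i q))) (α (i q)) (ha' _) ha, An.id_apply]
  obtain ⟨ψ, hψ, hψk⟩ := exists_hom_of_continuous (𝟙 S) ha hb k hkc h1
    (fun g q => by rw [← hp q, ← totalMap_act, hk, hk, totalMap_act])
    (fun q => by rw [← hp q, hk, toX_totalMap, toX_totalMap])
  refine ⟨ψ, ⟨hψ, fun j => hom_ext_totalMap fun x => ?_⟩, fun ψ' h' => hom_ext_totalMap fun q => ?_⟩
  · exact (congrFun hψk _).trans (hk j x)
  · rw [hψk, ← hp q, hk]
    exact congrArg (fun m => totalMap m (p q)) (h'.2 (i q))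

end

end OrbiStack

/-! ### Descent of objects. -/

namespace OrbiStack

open Topology

/-- Gluing of topological spaces along open subsets, over a base. -/
theorem exists_glued_topology {ι E S : Type*} {A : ι → Type*} [∀ i, TopologicalSpace (A i)]
    [∀ i, T2Space (A i)] [∀ i, SecondCountableTopology (A i)] [TopologicalSpace S] [T2Space S]
    [SecondCountableTopology S] {U : ι → Opens S} (hU : ⨆ i, U i = ⊤) {β : ∀ i, A i → E}
    {π : E → S} (hinj : ∀ i, Function.Injective (β i))
    (hrange : ∀ i e, π e ∈ U i ↔ e ∈ Set.range (β i))
    (hloc : ∀ i, IsLocalHomeomorph (π ∘ β i))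
    (hopen : ∀ i j (W : Set (A i)), IsOpen W → IsOpen (β j ⁻¹' (β i '' W))) :
    ∃ _ : TopologicalSpace E, T2Space E ∧ SecondCountableTopology E ∧ IsLocalHomeomorph π ∧
      ∀ i, IsOpenEmbedding (β i) := by
  let t : TopologicalSpace E := ⨆ i, TopologicalSpace.coinduced (β i) inferInstance
  have ht : ∀ W : Set E, IsOpen W ↔ ∀ i, IsOpen (β i ⁻¹' W) := fun W => by
    simp only [t, isOpen_iSup_iff, isOpen_coinduced]
  have hcov : ∀ s : S, ∃ i, s ∈ U i := fun s => Opens.mem_iSup.1 (hU ▸ trivial)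
  have hβ : ∀ i, IsOpenEmbedding (β i) := fun i =>
    .of_continuous_injective_isOpenMap ⟨fun W hW => (ht W).1 hW i⟩ (hinj i)
      fun W hW => (ht _).2 fun j => hopen i j W hW
  have hπc : Continuous π := ⟨fun W hW => (ht _).2 fun i => hW.preimage (hloc i).continuous⟩
  have hπ : IsLocalHomeomorph π := by
    refine isLocalHomeomorph_of_isOpenMap hπc (fun W hW => ?_) fun e => ?_
    · have : π '' W = ⋃ i, (π ∘ β i) '' (β i ⁻¹' W) := by
        ext s
        simp only [Set.mem_image, Set.mem_iUnion, Set.mem_preimage, Function.comp_apply]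
        constructor
        · rintro ⟨e, he, rfl⟩
          obtain ⟨i, hi⟩ := hcov (π e)
          obtain ⟨p, rfl⟩ := (hrange i e).1 hi
          exact ⟨i, p, he, rfl⟩
        · rintro ⟨i, p, hp, rfl⟩
          exact ⟨_, hp, rfl⟩
      rw [this]
      exact isOpen_iUnion fun i => (hloc i).isOpenMap _ ((ht W).1 hW i)
    · obtain ⟨i, hi⟩ := hcov (π e)
      obtain ⟨p, rfl⟩ := (hrange i e).1 hi
      obtain ⟨W, hW, hp, hWi⟩ := (hloc i).isLocallyInjective p
      refine ⟨β i '' W, (hβ i).isOpenMap _ hW, ⟨p, hp, rfl⟩, ?_⟩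
      rintro _ ⟨x, hx, rfl⟩ _ ⟨y, hy, rfl⟩ h
      rw [hWi hx hy h]
  refine ⟨t, ⟨fun e e' hne => ?_⟩, ?_, hπ, hβ⟩
  -- Points over different points of `S` are separated in `S`. Points in one fibre lie in a common
  -- piece, which is Hausdorff and embeds as an open set.
  · by_cases h : π e = π e'
    · obtain ⟨i, hi⟩ := hcov (π e)
      obtain ⟨p, rfl⟩ := (hrange i e).1 hi
      obtain ⟨q, rfl⟩ := (hrange i e').1 (h ▸ hi)
      obtain ⟨V, W, hV, hW, hp, hq, hd⟩ := t2_separation fun hpq : p = q => hne (hpq ▸ rfl)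
      exact ⟨_, _, (hβ i).isOpenMap _ hV, (hβ i).isOpenMap _ hW, ⟨p, hp, rfl⟩, ⟨q, hq, rfl⟩,
        (Set.disjoint_image_iff (hinj i)).2 hd⟩
    · exact separated_by_continuous hπc h
  -- The index set may be uncountable, but countably many `U i` already cover `S`, and the
  -- corresponding pieces cover `E`.
  · obtain ⟨J, hJ, hJU⟩ := TopologicalSpace.isOpen_iUnion_countable (fun i => (U i : Set S))
      fun i => (U i).2
    have := hJ.to_subtype
    have (i : ι) : SecondCountableTopology (Set.range (β i)) :=
      (hβ i).isEmbedding.toHomeomorph.symm.secondCountableTopology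
    refine secondCountableTopology_of_countable_cover (U := fun i : J => Set.range (β i))
      (fun i => (hβ i).isOpen_range) (Set.eq_univ_of_forall fun e => ?_)
    have he : π e ∈ ⋃ i ∈ J, (U i : Set S) := by
      rw [hJU]
      exact Set.mem_iUnion.2 (hcov _)
    obtain ⟨i, hi, he⟩ := Set.mem_iUnion₂.1 he
    exact Set.mem_iUnion.2 ⟨⟨i, hi⟩, (hrange i e).1 he⟩

theorem An.isEtale_inclOfLE (S : An.{u}) {U V : Opens S} (h : U ≤ V) : An.IsEtale (S.inclOfLE h) :=
  .of_comp (g := S.incl V) (An.isEtale_incl S U) (An.isEtale_incl S V)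

section

variable {G : Type u} [Group G] {X : An.{u}} {ρ : RightAction G X}

/-- Bundles on the members of an open covering glue when their total spaces glue as sets with an
action, a projection to the base and a map to `X`. -/
theorem exists_glued_object {S : An.{u}} {ι : Type u} {U : ι → Opens S} (hU : ⨆ i, U i = ⊤)
    {a : ι → (quotientStack ρ).obj} (ha : ∀ i, (quotientStack ρ).p.obj (a i) = S.openSub (U i))
    {E : Type u} {β : ∀ i, (QuotientObj.bundle (a i)).total → E} {π : E → S} {A : G → E → E}
    {v : E → X} (hinj : ∀ i, Function.Injective (β i))
    (hrange : ∀ i e, π e ∈ U i ↔ e ∈ Set.range (β i))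
    (hπ : ∀ i p, π (β i p) = (S.incl (U i)).toFun ((projTo (ha i)).toFun p))
    (hA : ∀ i g p, A g (β i p) = β i (((QuotientObj.bundle (a i)).action.act g).toFun p))
    (hv : ∀ i p, v (β i p) = (QuotientObj.toX (a i)).toFun p)
    (hopen : ∀ i j W, IsOpen W → IsOpen (β j ⁻¹' (β i '' W))) :
    ∃ (b : (quotientStack ρ).obj) (β' : ∀ i, a i ⟶ b), (quotientStack ρ).p.obj b = S ∧
      (∀ i, (quotientStack ρ).p.IsHomLift (S.incl (U i)) (β' i)) ∧
      ∀ i j p q, β i p = β j q → totalMap (β' i) p = totalMap (β' j) q := by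
  have het : ∀ i, An.IsEtale (projTo (ha i) ≫ S.incl (U i)) := fun i =>
    (isEtale_projTo (ha i)).comp (An.isEtale_incl S (U i))
  have hπ' : ∀ i, π ∘ β i = (projTo (ha i) ≫ S.incl (U i)).toFun := fun i => funext (hπ i)
  obtain ⟨t, _, _, hloc, hβ⟩ := exists_glued_topology hU hinj hrange
    (fun i => by rw [hπ']; exact (het i).isLocalHomeomorph) hopen
  have hcov : ∀ e, ∃ i p, β i p = e := fun e => by
    obtain ⟨i, hi⟩ := Opens.mem_iSup.1 (hU ▸ trivial : π e ∈ ⨆ i, U i)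
    exact ⟨i, (hrange i e).1 hi⟩
  let B := An.etaleSpace S E π hloc
  let pr : B ⟶ S := An.etaleProj S E π hloc
  have hpr : An.IsEtale pr := An.isEtale_etaleProj S E π hloc
  let βm : ∀ i, (QuotientObj.bundle (a i)).total ⟶ B := fun i =>
    ⟨β i, hpr.analytic_lift (hβ i).continuous ((projTo (ha i) ≫ S.incl (U i)).analytic.congr (hπ i))⟩
  have hβm : ∀ i, An.IsEtale (βm i) := fun i =>
    .of_comp (g := pr) (by
      rw [show βm i ≫ pr = projTo (ha i) ≫ S.incl (U i) from An.hom_ext (hπ i)]; exact het i) hpr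
  have hAc : ∀ g, Continuous (A g) := fun g => by
    rw [continuous_iff_continuousAt]
    intro e
    obtain ⟨i, p, rfl⟩ := hcov e
    rw [← (hβ i).continuousAt_iff, show A g ∘ β i = _ from funext (hA i g)]
    exact ((hβ i).continuous.comp (An.Hom.continuous _)).continuousAt
  let act : RightAction G B := .ofContinuous hpr A hAc
    (fun g e => by
      obtain ⟨i, p, rfl⟩ := hcov e
      change π (A g (β i p)) = π (β i p)
      rw [hA, hπ, hπ, projTo_act])
    (fun e => by
      obtain ⟨i, p, rfl⟩ := hcov e
      rw [hA, RightAction.act_one_apply])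
    (fun g h e => by
      obtain ⟨i, p, rfl⟩ := hcov e
      rw [hA, hA, hA, RightAction.act_mul_apply])
  let P : PrincipalBundle G S := .ofEtale pr act
    (fun g => An.hom_ext fun e => by
      obtain ⟨i, p, rfl⟩ := hcov e
      change π (A g (β i p)) = π (β i p)
      rw [hA, hπ, hπ, projTo_act]) hpr
    (fun s => by
      obtain ⟨i, hi⟩ := Opens.mem_iSup.1 (hU ▸ trivial : s ∈ ⨆ i, U i)
      obtain ⟨p, hp⟩ := projTo_surjective (ha i) (⟨s, hi⟩ : U i)
      exact ⟨β i p, (hπ i p).trans (congrArg (S.incl (U i)).toFun hp)⟩)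
    (fun e e' h => by
      obtain ⟨i, p, rfl⟩ := hcov e
      -- The range of `β i` is the full preimage of `U i`, so a fibre lies in a single piece and
      -- simple transitivity can be read off there.
      obtain ⟨q, rfl⟩ : e' ∈ Set.range (β i) := (hrange i e').1 (by
        rw [show π e' = π (β i p) from h.symm]
        exact (hrange i _).2 ⟨p, rfl⟩)
      have h' : (projTo (ha i)).toFun p = (projTo (ha i)).toFun q :=
        Subtype.val_injective (((hπ i p).symm.trans h).trans (hπ i q))
      obtain ⟨g, hg, hu⟩ := existsUnique_act_of_projTo (ha i) h'
      refine ⟨g, (hA i g p).trans (congrArg (β i) hg), fun g' hg' => hu g' ?_⟩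
      exact hinj i ((hA i g' p).symm.trans hg'))
  let vm : B ⟶ X := ⟨v, fun e => by
    obtain ⟨i, p, rfl⟩ := hcov e
    exact (hβm i).analyticAt_desc (((QuotientObj.toX (a i)).analytic.congr (hv i)) p)⟩
  let b : QuotientObj ρ :=
    { base := S
      bundle := P
      toX := vm
      equivariant := fun g => An.hom_ext fun e => by
        obtain ⟨i, p, rfl⟩ := hcov e
        change v (A g (β i p)) = (ρ.act g).toFun (v (β i p))
        rw [hA, hv, hv]
        exact congrFun (congrArg An.Hom.toFun (QuotientObj.equivariant (a i) g)) p }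
  have hm : ∀ i, ∃ φ : a i ⟶ (show (quotientStack ρ).obj from b),
      (quotientStack ρ).p.IsHomLift (S.incl (U i)) φ ∧ totalMap φ = β i := fun i =>
    exists_hom_of_continuous (b := b) (S.incl (U i)) (ha i) rfl (β i) (hβ i).continuous (hπ i)
      (fun g p => (hA i g p).symm) (hv i)
  choose φ hφ hφβ using hm
  exact ⟨b, φ, rfl, hφ, fun i j p q h => by rw [hφβ, hφβ]; exact h⟩

end

end OrbiStack

namespace OrbiStack

section

variable {G : Type u} [Group G] {X : An.{u}} {ρ : RightAction G X}

/-- The glued total space is the quotient of the disjoint union of the total spaces, where `p` and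
`q` are identified if they are the two images of a point of some `c i j`. Reflexivity is the
condition on `φ_{ii}`, transitivity is the cocycle condition, and symmetry follows from both. -/
theorem glue_obj_quotientStack (S : An.{u}) (ι : Type u) (U : ι → Opens S) (hU : ⨆ i, U i = ⊤)
    (a : ι → (quotientStack ρ).obj) (ha : ∀ i, (quotientStack ρ).p.obj (a i) = S.openSub (U i))
    (c : ι → ι → (quotientStack ρ).obj) (l : ∀ i j, c i j ⟶ a i) (r : ∀ i j, c i j ⟶ a j)
    (hl : ∀ i j, (quotientStack ρ).p.IsHomLift
      (S.inclOfLE (inf_le_left : U i ⊓ U j ≤ U i)) (l i j))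
    (hr : ∀ i j, (quotientStack ρ).p.IsHomLift
      (S.inclOfLE (inf_le_right : U i ⊓ U j ≤ U j)) (r i j))
    (hdiag : ∀ i, l i i = r i i)
    (hcoc : ∀ (i j k : ι) (d : (quotientStack ρ).obj) (x : d ⟶ c i j) (y : d ⟶ c j k)
      (z : d ⟶ c i k),
        (quotientStack ρ).p.IsHomLift (S.inclOfLE (inf_le_left : U i ⊓ U j ⊓ U k ≤ U i ⊓ U j)) x →
        (quotientStack ρ).p.IsHomLift (S.inclOfLE
          (inf_le_inf_right (U k) inf_le_right : U i ⊓ U j ⊓ U k ≤ U j ⊓ U k)) y →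
        (quotientStack ρ).p.IsHomLift (S.inclOfLE
          (inf_le_inf_right (U k) inf_le_left : U i ⊓ U j ⊓ U k ≤ U i ⊓ U k)) z →
        x ≫ l i j = z ≫ l i k → x ≫ r i j = y ≫ l j k → y ≫ r j k = z ≫ r i k) :
    ∃ (b : (quotientStack ρ).obj) (β : ∀ i, a i ⟶ b), (quotientStack ρ).p.obj b = S ∧
      (∀ i, (quotientStack ρ).p.IsHomLift (S.incl (U i)) (β i)) ∧
      ∀ i j, l i j ≫ β i = r i j ≫ β j := by
  have hc := fun i j => IsHomLift.domain_eq (quotientStack ρ).p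
    (S.inclOfLE (inf_le_left : U i ⊓ U j ≤ U i)) (l i j)
  have hlp : ∀ i j z, ((projTo (ha i)).toFun (totalMap (l i j) z)) =
      (S.inclOfLE (inf_le_left : U i ⊓ U j ≤ U i)).toFun ((projTo (hc i j)).toFun z) :=
    fun i j z => projTo_totalMap _ (l i j) (hc i j) (ha i) z
  have hrp : ∀ i j z, ((projTo (ha j)).toFun (totalMap (r i j) z)) =
      (S.inclOfLE (inf_le_right : U i ⊓ U j ≤ U j)).toFun ((projTo (hc i j)).toFun z) :=
    fun i j z => projTo_totalMap _ (r i j) (hc i j) (ha j) z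
  have hlinj : ∀ i j, Function.Injective (totalMap (l i j)) := fun i j =>
    totalMap_injective (f := S.inclOfLE (inf_le_left : U i ⊓ U j ≤ U i))
      (Set.inclusion_injective (inf_le_left : U i ⊓ U j ≤ U i)) (l i j)
  let T := Σ i, (QuotientObj.bundle (a i)).total
  let rel : T → T → Prop := fun p q =>
    ∃ z, totalMap (l p.1 q.1) z = p.2 ∧ totalMap (r p.1 q.1) z = q.2
  have hrel : ∀ {p q}, rel p q →
      ∃ i j z, p = ⟨i, totalMap (l i j) z⟩ ∧ q = ⟨j, totalMap (r i j) z⟩ := by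
    rintro ⟨i, p⟩ ⟨j, q⟩ ⟨z, h1, h2⟩
    exact ⟨i, j, z, congrArg (Sigma.mk i) h1.symm, congrArg (Sigma.mk j) h2.symm⟩
  let π : T → S := fun p => (S.incl (U p.1)).toFun ((projTo (ha p.1)).toFun p.2)
  have hπmem : ∀ p, π p ∈ U p.1 := fun p => Subtype.property (p := fun s => s ∈ U p.1) _
  have hπrel : ∀ p q, rel p q → π p = π q := by
    intro p q h
    obtain ⟨i, j, z, rfl, rfl⟩ := hrel h
    simp only [π, hlp, hrp]
    rfl
  have hrefl : ∀ p, rel p p := by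
    rintro ⟨i, p⟩
    obtain ⟨z, -, hz⟩ := exists_totalMap_eq (S.inclOfLE (inf_le_left : U i ⊓ U i ≤ U i)) (l i i) (hc i i) (ha i) (q := p)
      (t := (⟨π ⟨i, p⟩, hπmem ⟨i, p⟩, hπmem ⟨i, p⟩⟩ : (U i ⊓ U i : Opens S))) rfl
    exact ⟨z, hz, by rw [← hdiag]; exact hz⟩
  -- The cocycle condition on points. Restricting `c i j` to the triple intersection and using that
  -- `l j k` and `l i k` are cartesian produces the three morphisms to which `hcoc` applies; `x` and
  -- `y` then come from one point `w`.
  have hcomp : ∀ i j k x y, totalMap (r i j) x = totalMap (l j k) y →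
      ∃ z, totalMap (l i k) z = totalMap (l i j) x ∧ totalMap (r i k) z = totalMap (r j k) y := by
    intro i j k x y hxy
    let fx := S.inclOfLE (inf_le_left : U i ⊓ U j ⊓ U k ≤ U i ⊓ U j)
    let fy := S.inclOfLE (inf_le_inf_right (U k) inf_le_right : U i ⊓ U j ⊓ U k ≤ U j ⊓ U k)
    let fz := S.inclOfLE (inf_le_inf_right (U k) inf_le_left : U i ⊓ U j ⊓ U k ≤ U i ⊓ U k)
    let mx := Functor.IsPreFibered.pullbackMap (hc i j) fx
    have hd := IsHomLift.domain_eq (quotientStack ρ).p fx mx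
    have ey : fx ≫ S.inclOfLE (inf_le_right : U i ⊓ U j ≤ U j) =
      fy ≫ S.inclOfLE (inf_le_left : U j ⊓ U k ≤ U j) := rfl
    have ez : fx ≫ S.inclOfLE (inf_le_left : U i ⊓ U j ≤ U i) =
      fz ≫ S.inclOfLE (inf_le_left : U i ⊓ U k ≤ U i) := rfl
    let my := Functor.IsStronglyCartesian.map (quotientStack ρ).p
      (S.inclOfLE (inf_le_left : U j ⊓ U k ≤ U j)) (l j k) ey (mx ≫ r i j)
    let mz := Functor.IsStronglyCartesian.map (quotientStack ρ).p
      (S.inclOfLE (inf_le_left : U i ⊓ U k ≤ U i)) (l i k) ez (mx ≫ l i j)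
    have hy : my ≫ l j k = mx ≫ r i j := Functor.IsStronglyCartesian.fac ..
    have hz : mz ≫ l i k = mx ≫ l i j := Functor.IsStronglyCartesian.fac ..
    have hyz := hcoc i j k _ mx my mz inferInstance inferInstance inferInstance hz.symm hy.symm
    have hs : (S.incl (U i ⊓ U j)).toFun ((projTo (hc i j)).toFun x) ∈ U i ⊓ U j ⊓ U k := by
      refine ⟨Subtype.property (p := fun s => s ∈ U i ⊓ U j) _, ?_⟩
      have h1 := congrArg (S.incl (U j)).toFun
        ((hrp i j x).symm.trans ((congrArg (projTo (ha j)).toFun hxy).trans (hlp j k y)))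
      change (S.incl (U i ⊓ U j)).toFun ((projTo (hc i j)).toFun x) =
        (S.incl (U j ⊓ U k)).toFun ((projTo (hc j k)).toFun y) at h1
      rw [h1]
      exact (Subtype.property (p := fun s => s ∈ U j ⊓ U k) _).2
    obtain ⟨w, -, rfl⟩ := exists_totalMap_eq fx mx hd (hc i j)
      (q := x) (t := (⟨_, hs⟩ : (U i ⊓ U j ⊓ U k : Opens S))) rfl
    have h2 : totalMap my w = y := hlinj j k
      ((congrArg (fun m => totalMap m w) hy).trans hxy)
    refine ⟨totalMap mz w, congrArg (fun m => totalMap m w) hz, ?_⟩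
    rw [← h2]
    exact (congrArg (fun m => totalMap m w) hyz).symm
  have hsymm : ∀ {p q}, rel p q → rel q p := by
    intro p q h
    obtain ⟨i, j, x, rfl, rfl⟩ := hrel h
    obtain ⟨y, -, hy⟩ := exists_totalMap_eq (S.inclOfLE (inf_le_left : U j ⊓ U i ≤ U j)) (l j i) (hc j i) (ha j) (q := totalMap (r i j) x)
      (t := (⟨π ⟨j, totalMap (r i j) x⟩, hπmem ⟨j, totalMap (r i j) x⟩, by
        rw [← hπrel ⟨i, totalMap (l i j) x⟩ ⟨j, totalMap (r i j) x⟩ ⟨x, rfl, rfl⟩]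
        exact hπmem ⟨i, totalMap (l i j) x⟩⟩ : (U j ⊓ U i : Opens S))) rfl
    -- The cocycle condition with `k = i` leads to a point of `c i i`, on which `l` and `r`
    -- coincide.
    obtain ⟨z, hz1, hz2⟩ := hcomp i j i x y hy.symm
    exact ⟨y, hy, by rw [← hz2, ← hdiag, hz1]⟩
  have htrans : ∀ {p q s}, rel p q → rel q s → rel p s := by
    rintro ⟨i, p⟩ ⟨j, q⟩ ⟨k, s⟩ ⟨x, hx, hx'⟩ ⟨y, hy, hy'⟩
    obtain ⟨z, hz, hz'⟩ := hcomp i j k x y (hx'.trans hy.symm)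
    exact ⟨z, hz.trans hx, hz'.trans hy'⟩
  let R : Setoid T := ⟨rel, hrefl, hsymm, htrans⟩
  let β : ∀ i, (QuotientObj.bundle (a i)).total → Quotient R := fun i p => ⟦⟨i, p⟩⟧
  have hβ : ∀ i j p q, β i p = β j q ↔ ∃ z, totalMap (l i j) z = p ∧ totalMap (r i j) z = q :=
    fun i j p q => Quotient.eq (r := R)
  obtain ⟨b, β', hb, hβ', hβe⟩ := exists_glued_object hU ha (E := Quotient R) (β := β)
    (π := Quotient.lift π hπrel)
    (A := fun g => Quotient.map (fun p : T => ⟨p.1, ((QuotientObj.bundle (a p.1)).action.act g).toFun p.2⟩) (by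
      intro p q h
      obtain ⟨i, j, z, rfl, rfl⟩ := hrel h
      exact ⟨((QuotientObj.bundle (c i j)).action.act g).toFun z, totalMap_act _ g z,
        totalMap_act _ g z⟩))
    (v := Quotient.lift (fun p : T => (QuotientObj.toX (a p.1)).toFun p.2) (by
      intro p q h
      obtain ⟨i, j, z, rfl, rfl⟩ := hrel h
      exact (toX_totalMap _ z).trans (toX_totalMap _ z).symm))
    (fun i p q h => by
      obtain ⟨z, rfl, rfl⟩ := (hβ i i p q).1 h
      rw [hdiag])
    (fun i e => by
      constructor
      · obtain ⟨⟨j, p⟩, rfl⟩ := Quotient.exists_rep e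
        intro (he : π ⟨j, p⟩ ∈ U i)
        obtain ⟨y, -, hy⟩ := exists_totalMap_eq (S.inclOfLE (inf_le_left : U j ⊓ U i ≤ U j)) (l j i) (hc j i) (ha j) (q := p)
          (t := (⟨π ⟨j, p⟩, hπmem ⟨j, p⟩, he⟩ : (U j ⊓ U i : Opens S))) rfl
        exact ⟨totalMap (r j i) y, ((hβ j i _ _).2 ⟨y, hy, rfl⟩).symm⟩
      · rintro ⟨p, rfl⟩
        exact hπmem ⟨i, p⟩)
    (fun i p => rfl) (fun i g p => rfl) (fun i p => rfl)
    (fun i j W hW => by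
      -- The pieces are glued along open sets: pull `W` back by the continuous map `l i j`, then
      -- push it forward by `r i j`, which is étale and hence open.
      have : β j ⁻¹' (β i '' W) = totalMap (r i j) '' (totalMap (l i j) ⁻¹' W) := by
        ext q
        simp only [Set.mem_preimage, Set.mem_image, hβ]
        constructor
        · rintro ⟨p, hp, z, rfl, rfl⟩
          exact ⟨z, hp, rfl⟩
        · rintro ⟨z, hz, rfl⟩
          exact ⟨_, hz, z, rfl, rfl⟩
      rw [this]
      exact (isEtale_total_of_isHomLift (An.isEtale_inclOfLE S
        (inf_le_right : U i ⊓ U j ≤ U j)) (r i j)).isLocalHomeomorph.isOpenMap _ (hW.preimage (An.Hom.continuous _)))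
  exact ⟨b, β', hb, hβ', fun i j => hom_ext_totalMap fun z =>
    hβe i j _ _ ((hβ i j _ _).2 ⟨z, rfl, rfl⟩)⟩

variable (ρ) in
theorem isStack_quotientStack : IsStack (quotientStack ρ) where
  fibered := inferInstance
  groupoid S _ _ φ _ := isIso_of_isHomLift_id (S := S) φ
  glue_hom := glue_hom_quotientStack
  glue_obj := glue_obj_quotientStack

end

end OrbiStack

namespace OrbiStack

noncomputable section

/-! ### Sums of copies of a manifold -/

namespace An

section CopiesOf

variable (D : Type u) (M : An.{u}) (hc : Nonempty M → Countable D)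

theorem isLocalHomeomorph_sigma_snd :
    IsLocalHomeomorph fun x : (Σ _ : D, (M : Type u)) => x.2 := by
  refine isLocalHomeomorph_of_isOpenMap (continuous_sigma fun _ => continuous_id) ?_ ?_
  · exact isOpenMap_sigma.2 fun _ => IsOpenMap.id
  · rintro ⟨d, x⟩
    refine ⟨Set.range (Sigma.mk d), isOpen_range_sigmaMk, ⟨x, rfl⟩, ?_⟩
    rintro _ ⟨y, rfl⟩ _ ⟨z, rfl⟩ (h : y = z)
    rw [h]

include hc in
-- Countability of `D` matters only when `M` has a point, since otherwise the sum is empty. This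
-- weak form of the hypothesis allows an arbitrary `G` when `X` is empty.
theorem secondCountable_sigma : SecondCountableTopology (Σ _ : D, (M : Type u)) := by
  rcases isEmpty_or_nonempty (M : Type u) with h | h
  · have : IsEmpty (Σ _ : D, (M : Type u)) := ⟨fun x => h.elim x.2⟩
    exact (Topology.IsEmbedding.of_subsingleton fun _ => (PUnit.unit : PUnit.{1})).secondCountableTopology
  · have := hc h
    infer_instance

/-- The disjoint union of copies of `M`, indexed by `D`. -/
def copies : An.{u} :=
  have := secondCountable_sigma D M hc
  etaleSpace M (Σ _ : D, (M : Type u)) _ (isLocalHomeomorph_sigma_snd D M)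

/-- The projection of the disjoint union of copies of `M` to `M`. -/
def copiesProj : copies D M hc ⟶ M :=
  have := secondCountable_sigma D M hc
  etaleProj M (Σ _ : D, (M : Type u)) _ (isLocalHomeomorph_sigma_snd D M)

theorem isEtale_copiesProj : IsEtale (copiesProj D M hc) :=
  have := secondCountable_sigma D M hc
  isEtale_etaleProj M (Σ _ : D, (M : Type u)) _ (isLocalHomeomorph_sigma_snd D M)

variable {D M}

/-- The inclusion of a copy of `M`. -/
def copiesIncl (d : D) : M ⟶ copies D M hc :=
  ⟨fun x => (⟨d, x⟩ : Σ _ : D, (M : Type u)),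
    (isEtale_copiesProj D M hc).analytic_lift
      (continuous_sigmaMk (σ := fun _ : D => (M : Type u)) (i := d)) (𝟙 M : M ⟶ M).analytic⟩

theorem isEtale_copiesIncl (d : D) : IsEtale (copiesIncl hc d) :=
  .of_comp (g := copiesProj D M hc) (isEtale_of_isIso (𝟙 M)) (isEtale_copiesProj D M hc)

/-- The map from a disjoint union of copies of `M` given by a family of maps. -/
def copiesDesc {Z : An.{u}} (f : D → (M ⟶ Z)) : copies D M hc ⟶ Z :=
  ⟨fun x : (Σ _ : D, (M : Type u)) => (f x.1).toFun x.2, fun x : (Σ _ : D, (M : Type u)) =>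
    (isEtale_copiesIncl hc x.1).analyticAt_desc (x := x.2) ((f x.1).analytic x.2)⟩

@[simp] theorem copiesIncl_desc {Z : An.{u}} (f : D → (M ⟶ Z)) (d : D) :
    copiesIncl hc d ≫ copiesDesc hc f = f d := rfl

theorem copies_ext {Z : An.{u}} {f g : copies D M hc ⟶ Z}
    (h : ∀ d, copiesIncl hc d ≫ f = copiesIncl hc d ≫ g) : f = g :=
  hom_ext fun x : (Σ _ : D, (M : Type u)) => congrFun (congrArg Hom.toFun (h x.1)) x.2

end CopiesOf

end An

/-! ### Extension of the structure group -/

section Transversal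

variable {G : Type u} [Group G] (H : Subgroup G)

/-- A set of representatives, containing `1`, of the cosets `H g`. -/
def transversal : Set G := (H.exists_isComplement_right 1).choose

theorem one_mem_transversal : 1 ∈ transversal H := (H.exists_isComplement_right 1).choose_spec.2

/-- The decomposition of the elements of `G` as products of an element of `H` and a
representative. -/
def decompose : G ≃ H × transversal H :=
  (H.exists_isComplement_right 1).choose_spec.1.equiv

variable {H}

@[simp] theorem decompose_mul (a : H) (t : transversal H) : decompose H (a * t : G) = (a, t) :=
  (decompose H).apply_symm_apply (a, t)

theorem decompose_spec (g : G) : ((decompose H g).1 * (decompose H g).2 : G) = g :=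
  (decompose H).symm_apply_apply g

@[simp] theorem decompose_coe (t : transversal H) : decompose H (t : G) = (1, t) := by
  simpa using decompose_mul (1 : H) t

end Transversal

section Extension

variable {G : Type u} [Group G] {X : An.{u}} {ρ : RightAction G X} {H : Subgroup G} {S : An.{u}}
  (Q : PrincipalBundle H S) (hc : Nonempty Q.total → Countable (transversal H))

/-- The action of `G` on `P ×_H G`. -/
def extensionAction : RightAction G (An.copies (transversal H) Q.total hc) where
  -- The point `q` in the copy `t` stands for the class `[q, t]`. If `t g = h t'` with `h` in `H`,
  -- then `[q, t] · g = [q · h, t']`.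
  act g := An.copiesDesc hc fun t =>
    Q.action.act (decompose H (t * g : G)).1 ≫ An.copiesIncl hc (decompose H (t * g : G)).2
  act_one := An.copies_ext hc fun t => by
    rw [An.copiesIncl_desc, mul_one, decompose_coe, Q.action.act_one]
    rfl
  act_mul g h := An.copies_ext hc fun t => by
    rw [An.copiesIncl_desc, ← Category.assoc, An.copiesIncl_desc, Category.assoc,
      An.copiesIncl_desc, ← Category.assoc, ← Q.action.act_mul]
    -- If `t g = a t₁` and `t₁ h = b t₂`, then `t g h = (a b) t₂`, and the decomposition is unique.
    have : decompose H (t * (g * h) : G) = ((decompose H (t * g : G)).1 *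
        (decompose H ((decompose H (t * g : G)).2 * h : G)).1,
        (decompose H ((decompose H (t * g : G)).2 * h : G)).2) := by
      rw [← decompose_mul]
      congr 1
      rw [Subgroup.coe_mul, mul_assoc, decompose_spec, ← mul_assoc, ← mul_assoc, decompose_spec]
    rw [this]

/-- The extension `P ×_H G` of the structure group of a bundle. -/
def PrincipalBundle.extension : PrincipalBundle G S :=
  have het := (An.isEtale_copiesProj (transversal H) Q.total hc).comp Q.isEtale_proj
  .ofEtale (An.copiesProj (transversal H) Q.total hc ≫ Q.proj) (extensionAction Q hc)
    (fun g => An.copies_ext hc fun t => Q.act_proj (decompose H (t * g : G)).1) het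
    (fun s => by
      obtain ⟨q, rfl⟩ := Q.proj_surjective s
      exact ⟨(An.copiesIncl hc ⟨1, one_mem_transversal H⟩).toFun q, rfl⟩)
    (by
      rintro ⟨t, q⟩ ⟨t', q'⟩ h
      obtain ⟨a, ha, hu⟩ := Q.existsUnique_act (q := q) (q' := q') h
      have key : ∀ g : G, ((extensionAction Q hc).act g).toFun
          (⟨t, q⟩ : Σ _ : transversal H, (Q.total : Type u)) =
        (⟨(decompose H (t * g : G)).2, (Q.action.act (decompose H (t * g : G)).1).toFun q⟩ :
          Σ _ : transversal H, (Q.total : Type u)) := fun g => rfl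
      -- The element `g` sends `[q, t]` to `[q', t']` exactly when `t g = a t'`, with `a` the
      -- element of `H` that sends `q` to `q'`.
      refine ⟨(t : G)⁻¹ * (a * t'), ?_, fun g hg => ?_⟩
      · refine (key _).trans ?_
        rw [mul_inv_cancel_left, decompose_mul, ha]
      · have h1 := (key g).symm.trans hg
        have h2 : (decompose H (t * g : G)).2 = t' := congrArg Sigma.fst h1
        have h3 : (Q.action.act (decompose H (t * g : G)).1).toFun q = q' :=
          congrArg (fun x : Σ _ : transversal H, (Q.total : Type u) => x.2) h1
        rw [← hu _ h3, ← h2, decompose_spec, inv_mul_cancel_left])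

/-- The inclusion of a bundle into its extension. -/
def extensionIncl : Q.total ⟶ (Q.extension hc).total :=
  An.copiesIncl hc ⟨1, one_mem_transversal H⟩

theorem extensionIncl_act (a : H) : extensionIncl Q hc ≫ (Q.extension hc).action.act a =
    Q.action.act a ≫ extensionIncl Q hc := by
  change Q.action.act (decompose H (1 * a : G)).1 ≫ An.copiesIncl hc (decompose H (1 * a : G)).2 = _
  have : (1 * a : G) = a * (⟨1, one_mem_transversal H⟩ : transversal H) := by simp
  rw [this, decompose_mul]
  rfl

theorem extensionIncl_act_transversal (t : transversal H) :
    extensionIncl Q hc ≫ (Q.extension hc).action.act (t : G) = An.copiesIncl hc t := by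
  change Q.action.act (decompose H (1 * t : G)).1 ≫ An.copiesIncl hc (decompose H (1 * t : G)).2 = _
  rw [one_mul, decompose_coe, Q.action.act_one]
  rfl

variable {Q} {v : Q.total ⟶ X} (hv : ∀ a : H, Q.action.act a ≫ v = v ≫ ρ.act a)

/-- The object of the quotient stack given by a bundle with structure group `H` and an
`H`-equivariant map. -/
def extensionObj : QuotientObj ρ where
  base := S
  bundle := Q.extension hc
  toX := An.copiesDesc hc fun t => v ≫ ρ.act t
  equivariant g := An.copies_ext hc fun t => by
    change Q.action.act (decompose H (t * g : G)).1 ≫ v ≫ ρ.act (decompose H (t * g : G)).2 =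
      v ≫ ρ.act t ≫ ρ.act g
    rw [← Category.assoc, hv, Category.assoc, ← ρ.act_mul, ← ρ.act_mul, decompose_spec]

theorem extensionIncl_toX : extensionIncl Q hc ≫ (extensionObj hc hv).toX = v := by
  change v ≫ ρ.act 1 = v
  rw [ρ.act_one, Category.comp_id]

/-- The morphism from an extension that is given by an `H`-equivariant map. -/
def extensionDesc {R : QuotientObj ρ} (f : S ⟶ R.base) (s : Q.total ⟶ R.bundle.total)
    (hs : s ≫ R.bundle.proj = Q.proj ≫ f)
    (ha : ∀ a : H, Q.action.act a ≫ s = s ≫ R.bundle.action.act a) (hX : s ≫ R.toX = v) :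
    QuotientHom (extensionObj hc hv) R where
  base := f
  total := An.copiesDesc hc fun t => s ≫ R.bundle.action.act t
  comm := An.copies_ext hc fun t => by
    change (s ≫ R.bundle.action.act t) ≫ R.bundle.proj = Q.proj ≫ f
    rw [Category.assoc, R.bundle.act_proj, hs]
  equivariant g := An.copies_ext hc fun t => by
    change Q.action.act (decompose H (t * g : G)).1 ≫ s ≫
      R.bundle.action.act (decompose H (t * g : G)).2 =
      s ≫ R.bundle.action.act t ≫ R.bundle.action.act g
    rw [← Category.assoc, ha, Category.assoc, ← R.bundle.action.act_mul,
      ← R.bundle.action.act_mul, decompose_spec]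
  toX := An.copies_ext hc fun t => by
    change (s ≫ R.bundle.action.act t) ≫ R.toX = v ≫ ρ.act t
    rw [Category.assoc, R.equivariant, ← hX, Category.assoc]

theorem extensionIncl_desc {R : QuotientObj ρ} (f : S ⟶ R.base) (s : Q.total ⟶ R.bundle.total)
    (hs : s ≫ R.bundle.proj = Q.proj ≫ f)
    (ha : ∀ a : H, Q.action.act a ≫ s = s ≫ R.bundle.action.act a) (hX : s ≫ R.toX = v) :
    extensionIncl Q hc ≫ (extensionDesc hc hv f s hs ha hX).total = s := by
  change s ≫ R.bundle.action.act 1 = s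
  rw [RightAction.act_one, Category.comp_id]

/-- The copy of `Q` indexed by `t` is the translate by `t` of the copy indexed by `1`, so an
equivariant map is determined on the latter. With `extensionDesc` this is the universal property of
`P ×_H G`. -/
theorem extension_hom_ext {R : QuotientObj ρ} {φ ψ : QuotientHom (extensionObj hc hv) R}
    (h : extensionIncl Q hc ≫ φ.total = extensionIncl Q hc ≫ ψ.total) : φ = ψ := by
  have key (χ : QuotientHom (extensionObj hc hv) R) (t : transversal H) :
      (An.copiesIncl hc t : Q.total ⟶ (Q.extension hc).total) ≫ χ.total =
        (extensionIncl Q hc ≫ χ.total) ≫ R.bundle.action.act t := by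
    refine (congrArg (· ≫ χ.total) (extensionIncl_act_transversal Q hc t)).symm.trans ?_
    refine (Category.assoc _ _ _).trans ((congrArg (extensionIncl Q hc ≫ ·)
      (χ.equivariant t)).trans (Category.assoc _ _ _).symm)
  have h' : φ.total = ψ.total := An.copies_ext hc fun t =>
    (key φ t).trans ((congrArg (· ≫ R.bundle.action.act t) h).trans (key ψ t).symm)
  exact QuotientHom.ext (QuotientHom.base_eq_of_total_eq h') h'

end Extension

end

end OrbiStack

/-! ### Base changes: a criterion and their uniqueness. -/

namespace OrbiStack

noncomputable section

section BaseChange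

variable {𝒳 𝒴 : BasedCategory.{u, u + 1} An.{u}} {F : 𝒴 ⥤ᵇ 𝒳} {S M : An.{u}}
  {g : S.toStack ⥤ᵇ 𝒳} {f : M ⟶ S}

/-- A criterion for `f` to be a base change of a faithful morphism of stacks. -/
theorem isBaseChange_of_faithful (hF : ∀ {b b' : 𝒴.obj} {r r' : b ⟶ b'}, F.map r = F.map r' → r = r')
    (R : Over M → 𝒴.obj) (φ : ∀ m, g.obj ((Over.map f).obj m) ⟶ F.obj (R m))
    (hφ : ∀ m, IsIso (φ m)) (hφ' : ∀ m, 𝒳.p.IsHomLift (𝟙 m.left) (φ m))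
    (hex : ∀ {m m' : Over M} (k : m ⟶ m'),
      ∃ r : R m ⟶ R m', g.map ((Over.map f).map k) ≫ φ m' = φ m ≫ F.map r)
    (hfull : ∀ {m m' : Over M} (k : (Over.map f).obj m ⟶ (Over.map f).obj m') (r : R m ⟶ R m'),
      g.map k ≫ φ m' = φ m ≫ F.map r → k.left ≫ m'.hom = m.hom)
    (hess : ∀ (s : Over S) (b : 𝒴.obj) (ψ : g.obj s ⟶ F.obj b), IsIso ψ →
      𝒳.p.IsHomLift (𝟙 s.left) ψ → ∃ (m : s.left ⟶ M) (h : m ≫ f = s.hom) (r : R (Over.mk m) ⟶ b),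
        IsIso r ∧ g.map (Over.homMk (𝟙 _) (by simp [h]) : (Over.map f).obj (Over.mk m) ⟶ s) ≫ ψ =
          φ (Over.mk m) ≫ F.map r) :
    IsBaseChange F g f := by
  -- Since `F` is faithful and the `φ m` are invertible, `r` is determined by `k`; any choice is
  -- therefore functorial.
  choose r hr using @hex
  let E : Over M ⥤ (fibreProduct g F).obj :=
    { obj := fun m => ⟨⟨(Over.map f).obj m, R m, φ m⟩, hφ m, hφ' m⟩
      map := fun {m m'} k => ⟨⟨(Over.map f).map k, r k, hr k⟩⟩
      map_id := fun m => by
        refine ObjectProperty.hom_ext _ ?_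
        refine CommaMorphism.ext ((Over.map f).map_id m) (hF ?_)
        have h := hr (𝟙 m)
        rw [CategoryTheory.Functor.map_id, CategoryTheory.Functor.map_id, Category.id_comp] at h
        refine ((cancel_epi (φ m)).1 (h.symm.trans (Category.comp_id _).symm)).trans ?_
        exact (F.toFunctor.map_id _).symm
      map_comp := fun {m m' m''} k k' => by
        refine ObjectProperty.hom_ext _ ?_
        refine CommaMorphism.ext ((Over.map f).map_comp k k') (hF ((cancel_epi (φ m)).1 ?_))
        rw [← hr, Functor.map_comp, Functor.map_comp, Category.assoc, hr k', ← Category.assoc,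
          hr k, Category.assoc]
        exact congrArg (φ m ≫ ·) (F.toFunctor.map_comp _ _).symm }
  have : E.Faithful := ⟨fun {m m'} k k' h => by
    have h1 : (Over.map f).map k = (Over.map f).map k' :=
      congrArg (fun x : E.obj m ⟶ E.obj m' => x.hom.left) h
    ext1
    exact congrArg (fun x : (Over.map f).obj m ⟶ (Over.map f).obj m' => x.left) h1⟩
  have : E.Full := ⟨fun {m m'} x => by
    have hx : g.map x.hom.left ≫ φ m' = φ m ≫ F.map x.hom.right := x.hom.w
    let k : m ⟶ m' := Over.homMk x.hom.left.left (hfull _ _ hx)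
    refine ⟨k, ?_⟩
    refine ObjectProperty.hom_ext _ ?_
    have hk : (Over.map f).map k = x.hom.left := by ext1; rfl
    refine CommaMorphism.ext hk (hF ((cancel_epi (φ m)).1 ?_))
    rw [← hx, ← hk]
    exact (hr k).symm⟩
  have : E.EssSurj := ⟨fun y => by
    obtain ⟨m, h, r, hr', h'⟩ := hess y.obj.left y.obj.right y.obj.hom y.property.1 y.property.2
    let l : (Over.map f).obj (Over.mk m) ≅ y.obj.left := Over.isoMk (Iso.refl _) (by simp [h])
    exact ⟨Over.mk m, ⟨ObjectProperty.isoMk _ (Comma.isoMk l (asIso r) h')⟩⟩⟩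
  exact ⟨⟨E, rfl⟩, { }, rfl⟩

/-- Both slice categories are equivalent to the fibre product, compatibly with the projections to
`S`. The resulting equivalence preserves terminal objects, which are the identities of `M` and `M₀`;
projecting to `S` gives the isomorphism. -/
theorem IsBaseChange.exists_iso {M₀ : An.{u}} {f₀ : M₀ ⟶ S} (h : IsBaseChange F g f)
    (h₀ : IsBaseChange F g f₀) : ∃ θ : M ≅ M₀, θ.hom ≫ f₀ = f := by
  obtain ⟨E, hE, e⟩ := h
  obtain ⟨E₀, hE₀, e₀⟩ := h₀
  let K : Over M ⥤ Over M₀ := E.toFunctor ⋙ E₀.toFunctor.inv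
  let i : K ⋙ Over.map f₀ ≅ Over.map f :=
    Functor.isoWhiskerLeft K (eqToIso e₀.symm) ≪≫
      Functor.isoWhiskerLeft E.toFunctor
        (Functor.isoWhiskerRight E₀.toFunctor.asEquivalence.counitIso (fibreProductFst g F).toFunctor)
      ≪≫ eqToIso e
  let t : K.obj (Over.mk (𝟙 M)) ≅ Over.mk (𝟙 M₀) :=
    (Over.mkIdTerminal.isTerminalObj K _).uniqueUpToIso Over.mkIdTerminal
  let j : Over.mk f₀ ≅ Over.mk f :=
    Over.isoMk (Iso.refl _) ≪≫ (Over.map f₀).mapIso t.symm ≪≫ i.app _ ≪≫ Over.isoMk (Iso.refl _)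
  exact ⟨(Over.forget S).mapIso j.symm, Over.w j.inv⟩

end BaseChange

end

end OrbiStack

namespace OrbiStack

noncomputable section

variable {G : Type u} [Group G] {X : An.{u}} {ρ : RightAction G X}

section

variable {H : Subgroup G} {S S' S'' : An.{u}} {Q : PrincipalBundle H S} {Q' : PrincipalBundle H S'}
  (hc : Nonempty Q.total → Countable (transversal H)) {v : Q.total ⟶ X}
  (hv : ∀ a : H, Q.action.act a ≫ v = v ≫ ρ.act a)
  (hc' : Nonempty Q'.total → Countable (transversal H)) {v' : Q'.total ⟶ X}
  (hv' : ∀ a : H, Q'.action.act a ≫ v' = v' ≫ ρ.act a)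

/-- The morphism of extensions that is given by a morphism of bundles with structure group `H`. -/
def extensionMap (f : S ⟶ S') (s : Q.total ⟶ Q'.total) (hs : s ≫ Q'.proj = Q.proj ≫ f)
    (ha : ∀ a : H, Q.action.act a ≫ s = s ≫ Q'.action.act a) (hX : s ≫ v' = v) :
    QuotientHom (extensionObj hc hv) (extensionObj hc' hv') :=
  extensionDesc hc hv f (s ≫ extensionIncl Q' hc') hs
    (fun a => (congrArg (· ≫ extensionIncl Q' hc') (ha a)).trans
      (congrArg (s ≫ ·) (extensionIncl_act Q' hc' a).symm))
    ((congrArg (s ≫ ·) (extensionIncl_toX hc' hv')).trans hX)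

theorem extensionIncl_map (f : S ⟶ S') (s : Q.total ⟶ Q'.total) (hs : s ≫ Q'.proj = Q.proj ≫ f)
    (ha : ∀ a : H, Q.action.act a ≫ s = s ≫ Q'.action.act a) (hX : s ≫ v' = v) :
    extensionIncl Q hc ≫ (extensionMap hc hv hc' hv' f s hs ha hX).total =
      s ≫ extensionIncl Q' hc' :=
  extensionIncl_desc _ _ _ _ _ _ _

end

/-! ### The canonical atlas -/

section Atlas

variable (hG : Nonempty X → Countable G)

/-- The bundle with trivial structure group. -/
def trivialBundle (G : Type u) [Group G] (T : An.{u}) : PrincipalBundle (⊥ : Subgroup G) T :=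
  .ofEtale (𝟙 T) ⟨fun _ => 𝟙 T, rfl, fun _ _ => rfl⟩ (fun _ => rfl) (An.isEtale_of_isIso _)
    (fun t => ⟨t, rfl⟩) (fun _ _ h => ⟨1, h, fun _ _ => Subsingleton.elim _ _⟩)

include hG in
-- A point of `T` yields a point of `X`, so a total space that maps to `X` is either empty or comes
-- with a countable `G`.
theorem countable_transversal {H : Subgroup G} {T : An.{u}} (v : T ⟶ X) :
    Nonempty T → Countable (transversal H) := fun ⟨t⟩ =>
  have := hG ⟨v.toFun t⟩
  inferInstance

theorem trivialBundle_equivariant {T : An.{u}} (v : T ⟶ X) (a : (⊥ : Subgroup G)) :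
    (trivialBundle G T).action.act a ≫ v = v ≫ ρ.act a := by
  rw [show (a : G) = 1 from a.2, ρ.act_one]
  rfl

/-- The trivial bundle with the equivariant map that is given by a map from the base to `X`. -/
def atlasObj (ρ : RightAction G X) (u : Over X) : QuotientObj ρ :=
  extensionObj (Q := trivialBundle G u.left) (countable_transversal hG u.hom)
    (trivialBundle_equivariant u.hom)

/-- The canonical section of the trivial bundle. -/
def atlasSection (u : Over X) : u.left ⟶ (atlasObj hG ρ u).bundle.total :=
  extensionIncl (trivialBundle G u.left) _

theorem atlasSection_proj (u : Over X) :
    atlasSection hG u ≫ (atlasObj hG ρ u).bundle.proj = 𝟙 _ := rfl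

theorem atlasSection_toX (u : Over X) : atlasSection hG u ≫ (atlasObj hG ρ u).toX = u.hom :=
  extensionIncl_toX (Q := trivialBundle G u.left) _ _

theorem atlas_hom_ext {u : Over X} {R : QuotientObj ρ} {φ ψ : QuotientHom (atlasObj hG ρ u) R}
    (h : atlasSection hG u ≫ φ.total = atlasSection hG u ≫ ψ.total) : φ = ψ :=
  extension_hom_ext (Q := trivialBundle G u.left) _ _ h

/-- The morphism from a trivial bundle that is given by a section. -/
def atlasDesc {u : Over X} {R : QuotientObj ρ} (f : u.left ⟶ R.base) (s : u.left ⟶ R.bundle.total)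
    (hs : s ≫ R.bundle.proj = f) (hX : s ≫ R.toX = u.hom) : QuotientHom (atlasObj hG ρ u) R :=
  extensionDesc (Q := trivialBundle G u.left) _ _ f s hs
    (fun a => by
      rw [show (a : G) = 1 from a.2, R.bundle.action.act_one]
      rfl) hX

theorem atlasSection_desc {u : Over X} {R : QuotientObj ρ} (f : u.left ⟶ R.base)
    (s : u.left ⟶ R.bundle.total) (hs : s ≫ R.bundle.proj = f) (hX : s ≫ R.toX = u.hom) :
    atlasSection hG u ≫ (atlasDesc hG f s hs hX).total = s :=
  extensionIncl_desc (Q := trivialBundle G u.left) _ _ _ _ _ _ _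

/-- The morphism of trivial bundles that is given by a morphism of the bases. -/
def atlasMap {u u' : Over X} (k : u ⟶ u') : QuotientHom (atlasObj hG ρ u) (atlasObj hG ρ u') :=
  atlasDesc hG k.left (k.left ≫ atlasSection hG u') rfl
    ((congrArg (k.left ≫ ·) (atlasSection_toX hG u')).trans (Over.w k))

theorem atlasSection_map {u u' : Over X} (k : u ⟶ u') :
    atlasSection hG u ≫ (atlasMap hG k : QuotientHom (atlasObj hG ρ u) _).total =
      k.left ≫ atlasSection hG u' :=
  atlasSection_desc _ _ _ _ _

/-- The canonical atlas of `[X/G]`. -/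
def atlas (ρ : RightAction G X) : X.toStack ⥤ᵇ quotientStack ρ where
  obj := atlasObj hG ρ
  map k := atlasMap hG k
  map_id u := atlas_hom_ext hG ((atlasSection_map hG (𝟙 u)).trans (Category.comp_id _).symm)
  map_comp {u u' u''} k k' := atlas_hom_ext hG <| by
    refine (atlasSection_map hG (k ≫ k')).trans ?_
    refine Eq.trans ?_ (Category.assoc _ _ _)
    refine Eq.trans ?_ (congrArg (· ≫ (atlasMap hG k' : QuotientHom (atlasObj hG ρ u') _).total)
      (atlasSection_map hG k).symm)
    exact congrArg (k.left ≫ ·) (atlasSection_map hG k').symm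
  w := rfl

theorem isCanonicalAtlas_atlas : IsCanonicalAtlas ρ (atlas hG ρ) :=
  ⟨rfl, atlasSection hG (Over.mk (𝟙 X)), atlasSection_proj hG _, atlasSection_toX hG _⟩

end Atlas

/-! ### The extension of the structure group as a morphism of stacks -/

section ExtensionFunctor

variable (hG : Nonempty X → Countable G) (H : Subgroup G) (Y : Opens X)
  (hY : ∀ h ∈ H, ∀ y ∈ Y, ρ.act h y ∈ Y)

variable {H Y hY} in
theorem equivariant_toX_incl (P : QuotientObj (ρ.restrict H Y hY)) (a : H) :
    P.bundle.action.act a ≫ P.toX ≫ X.incl Y = (P.toX ≫ X.incl Y) ≫ ρ.act a :=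
  congrArg (· ≫ X.incl Y) (P.equivariant a)

/-- The object `P ×_H G`. -/
def extensionFunctorObj (P : QuotientObj (ρ.restrict H Y hY)) : QuotientObj ρ :=
  extensionObj (Q := P.bundle) (countable_transversal hG (P.toX ≫ X.incl Y))
    (equivariant_toX_incl P)

/-- The canonical map from `P` to `P ×_H G`. -/
def unitMap (P : QuotientObj (ρ.restrict H Y hY)) :
    P.bundle.total ⟶ (extensionFunctorObj hG H Y hY P).bundle.total :=
  extensionIncl P.bundle _

theorem unitMap_proj (P : QuotientObj (ρ.restrict H Y hY)) :
    unitMap hG H Y hY P ≫ (extensionFunctorObj hG H Y hY P).bundle.proj = P.bundle.proj := rfl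

theorem unitMap_act (P : QuotientObj (ρ.restrict H Y hY)) (a : H) :
    P.bundle.action.act a ≫ unitMap hG H Y hY P =
      unitMap hG H Y hY P ≫ (extensionFunctorObj hG H Y hY P).bundle.action.act a :=
  (extensionIncl_act P.bundle _ a).symm

theorem unitMap_toX (P : QuotientObj (ρ.restrict H Y hY)) :
    unitMap hG H Y hY P ≫ (extensionFunctorObj hG H Y hY P).toX = P.toX ≫ X.incl Y :=
  extensionIncl_toX (Q := P.bundle) _ _

variable {hG H Y hY} in
theorem extensionFunctor_hom_ext {P : QuotientObj (ρ.restrict H Y hY)} {R : QuotientObj ρ}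
    {φ ψ : QuotientHom (extensionFunctorObj hG H Y hY P) R}
    (h : unitMap hG H Y hY P ≫ φ.total = unitMap hG H Y hY P ≫ ψ.total) : φ = ψ :=
  extension_hom_ext (Q := P.bundle) _ _ h

/-- The map of extensions that is given by a map of bundles. -/
def extensionFunctorMap {P P' : QuotientObj (ρ.restrict H Y hY)} (m : QuotientHom P P') :
    QuotientHom (extensionFunctorObj hG H Y hY P) (extensionFunctorObj hG H Y hY P') :=
  extensionMap (Q := P.bundle) (Q' := P'.bundle) _ _ _ _ m.base m.total m.comm m.equivariant
    (congrArg (· ≫ X.incl Y) m.toX)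

theorem unitMap_map {P P' : QuotientObj (ρ.restrict H Y hY)} (m : QuotientHom P P') :
    unitMap hG H Y hY P ≫ (extensionFunctorMap hG H Y hY m).total =
      m.total ≫ unitMap hG H Y hY P' :=
  extensionIncl_map (Q := P.bundle) (Q' := P'.bundle) _ _ _ _ _ _ _ _ _

/-- The canonical morphism `[Y/H] ⥤ᵇ [X/G]`. -/
def extensionFunctor : quotientStack (ρ.restrict H Y hY) ⥤ᵇ quotientStack ρ where
  obj := extensionFunctorObj hG H Y hY
  map m := extensionFunctorMap hG H Y hY m
  map_id P := extensionFunctor_hom_ext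
    ((unitMap_map hG H Y hY (𝟙 P : P ⟶ P)).trans (Category.comp_id _).symm)
  map_comp {P P' P''} m m' := extensionFunctor_hom_ext <| by
    refine (unitMap_map hG H Y hY (m ≫ m' : P ⟶ P'')).trans ?_
    refine Eq.trans ?_ (Category.assoc _ _ _)
    refine Eq.trans ?_ (congrArg (· ≫ (extensionFunctorMap hG H Y hY m').total)
      (unitMap_map hG H Y hY m).symm)
    exact congrArg (QuotientHom.total m ≫ ·) (unitMap_map hG H Y hY m').symm
  w := rfl

theorem isCanonicalMap_extensionFunctor :
    IsCanonicalMap ρ H Y hY (extensionFunctor hG H Y hY) :=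
  ⟨unitMap hG H Y hY, fun P => ⟨rfl, unitMap_proj hG H Y hY P⟩, unitMap_act hG H Y hY,
    unitMap_toX hG H Y hY, fun _ _ m => (unitMap_map hG H Y hY m).symm⟩

end ExtensionFunctor

end

end OrbiStack

/-! ### The canonical morphism `X → [X/G]` is an atlas. -/

namespace OrbiStack

noncomputable section

open CategoryTheory.Functor

variable {G : Type u} [Group G] {X : An.{u}} {ρ : RightAction G X}

theorem isHomLift_base_comp {S : An.{u}} {a b : (quotientStack ρ).obj} (φ : a ⟶ b)
    (hb : (quotientStack ρ).p.obj b = S) :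
    (quotientStack ρ).p.IsHomLift (QuotientHom.base φ ≫ eqToHom hb) φ := by
  subst hb
  exact (Category.comp_id (QuotientHom.base φ)).symm ▸ CategoryTheory.IsHomLift.map (quotientStack ρ).p φ

section

variable {S : An.{u}} (g : S.toStack ⥤ᵇ quotientStack ρ)

/-- The morphism from the restriction of an object along a map `y`. -/
def restrictionHom (y : Over S) : g.obj y ⟶ g.obj (Over.mk (𝟙 S)) :=
  g.map (Over.homMk y.hom (Category.comp_id _))

instance isHomLift_map {y y' : Over S} (k : y ⟶ y') :
    (quotientStack ρ).p.IsHomLift k.left (g.map k) :=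
  have : S.toStack.p.IsHomLift k.left k := CategoryTheory.IsHomLift.map S.toStack.p k
  BasedFunctor.preserves_isHomLift g k.left k

instance isHomLift_restrictionHom (y : Over S) :
    (quotientStack ρ).p.IsHomLift y.hom (restrictionHom g y) :=
  isHomLift_map g (Over.homMk y.hom (Category.comp_id _) : y ⟶ Over.mk (𝟙 S))

@[simp] theorem map_restrictionHom {y y' : Over S} (k : y ⟶ y') :
    g.map k ≫ restrictionHom g y' = restrictionHom g y := by
  refine (g.toFunctor.map_comp _ _).symm.trans (congrArg g.map ?_)
  ext1
  exact Over.w k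

variable (hG : Nonempty X → Countable G)

/-- The projection of the total space of the bundle that is classified by a morphism to `[X/G]`. -/
def classifiedProj : (QuotientObj.bundle (g.obj (Over.mk (𝟙 S)))).total ⟶ S :=
  projTo (g.w_obj _)

/-- A map `T → P` is a section of the pull-back of `P` along `T → P → S`, hence defines a morphism
to `P` from the trivial bundle on `T`. -/
theorem exists_trivialization (m : Over (QuotientObj.bundle (g.obj (Over.mk (𝟙 S)))).total) :
    ∃ χ : (atlas hG ρ).obj ((Over.map (QuotientObj.toX (g.obj (Over.mk (𝟙 S))))).obj m) ⟶
        g.obj (Over.mk (𝟙 S)),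
      (quotientStack ρ).p.IsHomLift (m.hom ≫ classifiedProj g) χ ∧
      atlasSection hG _ ≫ QuotientHom.total χ = m.hom :=
  let P : QuotientObj ρ := g.obj (Over.mk (𝟙 S))
  let D : QuotientHom (atlasObj hG ρ ((Over.map P.toX).obj m)) P :=
    atlasDesc hG (m.hom ≫ P.bundle.proj) m.hom rfl rfl
  ⟨D, (Category.assoc _ _ _ : (m.hom ≫ P.bundle.proj) ≫ _ = _) ▸
    isHomLift_base_comp (a := atlasObj hG ρ ((Over.map P.toX).obj m)) (b := P) D (g.w_obj _),
    atlasSection_desc hG _ _ _ _⟩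

theorem atlas_faithful {u u' : Over X} {r r' : u ⟶ u'}
    (h : (atlas hG ρ).map r = (atlas hG ρ).map r') : r = r' := by
  ext1
  exact congrArg QuotientHom.base h

/-- A `T`-point of the fibre product is a map `y : T → S`, a map `b : T → X` and an isomorphism of
`y^* P` with the trivial bundle with map `b`. The image of the canonical section is a lift of `y` to
`P` whose composite with the map to `X` is `b`, and such a lift determines the isomorphism. -/
theorem isBaseChange_atlas : IsBaseChange (atlas hG ρ) g (classifiedProj g) := by
  choose χ hχ hχ' using exists_trivialization g hG
  have hχc (m) := isStronglyCartesian_quotientStack (m.hom ≫ classifiedProj g) (χ m)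
  have hm (m) : ((Over.map (classifiedProj g)).obj m).hom = 𝟙 _ ≫ m.hom ≫ classifiedProj g :=
    (Category.id_comp _).symm
  -- The restriction of `P` and the trivial bundle both map to `P` over the same map to `S`; as `χ
  -- m` is cartesian, the first factors through the second.
  let φ (m) : g.obj ((Over.map (classifiedProj g)).obj m) ⟶ _ :=
    IsStronglyCartesian.map (quotientStack ρ).p (m.hom ≫ classifiedProj g) (χ m) (hm m)
      (restrictionHom g _)
  have hφ (m) : (quotientStack ρ).p.IsHomLift (𝟙 m.left) (φ m) :=
    IsStronglyCartesian.map_isHomLift _ _ _ _ _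
  have hφχ (m) : φ m ≫ χ m = restrictionHom g _ := IsStronglyCartesian.fac _ _ _ _ _
  have hmap {u u' : Over X} (r : u ⟶ u') :
      (quotientStack ρ).p.IsHomLift r.left ((atlas hG ρ).map r) :=
    CategoryTheory.IsHomLift.map (quotientStack ρ).p ((atlas hG ρ).map r)
  have hiso (m) : IsIso (φ m) := isIso_of_isHomLift_id (S := m.left) _
  have hsec {m m'} (r : (Over.map (QuotientObj.toX (g.obj (Over.mk (𝟙 S))))).obj m ⟶
      (Over.map (QuotientObj.toX (g.obj (Over.mk (𝟙 S))))).obj m') :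
      atlasSection hG _ ≫ QuotientHom.total ((atlas hG ρ).map r ≫ χ m') = r.left ≫ m'.hom := by
    refine (Category.assoc _ _ _).symm.trans ?_
    refine (congrArg (· ≫ QuotientHom.total (χ m')) (atlasSection_map hG r)).trans ?_
    exact (Category.assoc _ _ _).trans (congrArg (r.left ≫ ·) (hχ' m'))
  -- Morphisms out of a trivial bundle are compared on the canonical section, where the equation
  -- says that `r` is a map over `P` and not only over `X`.
  have hχm {m m'} (r : (Over.map (QuotientObj.toX (g.obj (Over.mk (𝟙 S))))).obj m ⟶
      (Over.map (QuotientObj.toX (g.obj (Over.mk (𝟙 S))))).obj m') :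
      (atlas hG ρ).map r ≫ χ m' = χ m ↔ r.left ≫ m'.hom = m.hom := by
    rw [← hsec, ← hχ' m]
    exact ⟨fun h => by rw [h], fun h => atlas_hom_ext hG h⟩
  refine isBaseChange_of_faithful (atlas_faithful hG)
    (Over.map (QuotientObj.toX (g.obj (Over.mk (𝟙 S))))).obj φ hiso hφ ?_ ?_ ?_
  · intro m m' k
    refine ⟨(Over.map _).map k, ?_⟩
    have h1 : (quotientStack ρ).p.IsHomLift k.left
        (g.map ((Over.map (classifiedProj g)).map k) ≫ φ m') :=
      have : (quotientStack ρ).p.IsHomLift k.left (g.map ((Over.map (classifiedProj g)).map k)) :=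
        isHomLift_map g ((Over.map (classifiedProj g)).map k)
      IsHomLift.comp_lift_id_right' _ k.left _ m'.left _
    have h2 : (quotientStack ρ).p.IsHomLift k.left (φ m ≫ (atlas hG ρ).map ((Over.map _).map k)) :=
      have : (quotientStack ρ).p.IsHomLift k.left ((atlas hG ρ).map ((Over.map _).map k)) :=
        hmap ((Over.map (QuotientObj.toX (g.obj (Over.mk (𝟙 S))))).map k)
      IsHomLift.comp_lift_id_left' _ m.left _ k.left _
    refine IsStronglyCartesian.ext (quotientStack ρ).p (m'.hom ≫ classifiedProj g) (χ m') k.left ?_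
    rw [Category.assoc, hφχ, map_restrictionHom, Category.assoc,
      (hχm ((Over.map _).map k)).2 (Over.w k), hφχ]
  · intro m m' k r h
    have h1 : k.left = r.left := by
      have := isHomLift_map g k
      have h1 : (quotientStack ρ).p.IsHomLift k.left (g.map k ≫ φ m') :=
        IsHomLift.comp_lift_id_right' _ k.left _ m'.left _
      have h2 : (quotientStack ρ).p.IsHomLift r.left (g.map k ≫ φ m') := h ▸
        have := hmap r
        IsHomLift.comp_lift_id_left' _ m.left _ r.left _
      exact (IsHomLift.fac (quotientStack ρ).p k.left (g.map k ≫ φ m')).trans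
        (IsHomLift.fac (quotientStack ρ).p r.left (g.map k ≫ φ m')).symm
    refine (congrArg (· ≫ m'.hom) h1).trans ((hχm r).1 ((cancel_epi (φ m)).1 ?_))
    rw [← Category.assoc, ← h, Category.assoc, hφχ, hφχ, map_restrictionHom]
  · rintro s ⟨T, ⟨⟨⟩⟩, b⟩ ψ hψ hψ'
    obtain rfl : T = s.left := IsHomLift.codomain_eq (quotientStack ρ).p (𝟙 s.left) ψ
    have : (quotientStack ρ).p.IsHomLift (𝟙 s.left) (CategoryTheory.inv ψ) := inferInstance
    let χ' : (atlas hG ρ).obj (Over.mk b) ⟶ g.obj (Over.mk (𝟙 S)) := CategoryTheory.inv ψ ≫ restrictionHom g s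
    have hχ'' : (quotientStack ρ).p.IsHomLift s.hom χ' :=
      IsHomLift.comp_lift_id_left' (quotientStack ρ).p s.left (CategoryTheory.inv ψ) s.hom
        (restrictionHom g s)
    let σ : s.left ⟶ (atlasObj hG ρ (Over.mk b)).bundle.total := atlasSection hG (Over.mk b)
    -- The required point of `P` is the image of the canonical section under the given
    -- trivialisation.
    let m : s.left ⟶ (QuotientObj.bundle (g.obj (Over.mk (𝟙 S)))).total :=
      σ ≫ QuotientHom.total χ'
    have hm' : m ≫ classifiedProj g = s.hom := An.hom_ext fun t =>
      projTo_totalMap s.hom χ' rfl (g.w_obj (Over.mk (𝟙 S))) (σ.toFun t)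
    have hmX : m ≫ QuotientObj.toX (g.obj (Over.mk (𝟙 S))) = b :=
      (Category.assoc _ _ _).trans
        ((congrArg (σ ≫ ·) (QuotientHom.toX χ')).trans (atlasSection_toX hG _))
    let r : (Over.map (QuotientObj.toX (g.obj (Over.mk (𝟙 S))))).obj (Over.mk m) ≅ Over.mk b :=
      Over.isoMk (Iso.refl _) ((Category.id_comp b).trans hmX.symm)
    have hr : (atlas hG ρ).map r.hom ≫ χ' = χ (Over.mk m) := by
      refine atlas_hom_ext hG (Eq.trans ?_ (hχ' (Over.mk m)).symm)
      refine (Category.assoc _ _ _).symm.trans ?_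
      exact congrArg (· ≫ QuotientHom.total χ') (atlasSection_map hG r.hom)
    refine ⟨m, hm', r.hom, inferInstance, ?_⟩
    have := isStronglyCartesian_quotientStack s.hom χ'
    let l : (Over.map (classifiedProj g)).obj (Over.mk m) ⟶ s :=
      Over.homMk (𝟙 s.left) (by simp [hm'])
    have h1 : (quotientStack ρ).p.IsHomLift (𝟙 s.left) (g.map l ≫ ψ) :=
      have : (quotientStack ρ).p.IsHomLift (𝟙 s.left) (g.map l) := isHomLift_map g l
      IsHomLift.comp_lift_id_right' _ (𝟙 s.left) _ s.left _
    have h2 : (quotientStack ρ).p.IsHomLift (𝟙 s.left) (φ (Over.mk m) ≫ (atlas hG ρ).map r.hom) :=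
      have : (quotientStack ρ).p.IsHomLift (𝟙 s.left) ((atlas hG ρ).map r.hom) := hmap r.hom
      IsHomLift.comp_lift_id_right' _ (𝟙 s.left) _ s.left _
    refine IsStronglyCartesian.ext (quotientStack ρ).p s.hom χ' (𝟙 s.left) ?_
    rw [Category.assoc, Category.assoc, hr, hφχ, IsIso.hom_inv_id_assoc, map_restrictionHom]

theorem isRepresentable_atlas : IsRepresentable (atlas hG ρ) := fun _ g =>
  ⟨_, classifiedProj g, isBaseChange_atlas g hG⟩

theorem isStackSubmersion_atlas : IsStackSubmersion (atlas hG ρ) := by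
  refine ⟨isRepresentable_atlas hG, fun S M g f hf => ?_⟩
  obtain ⟨θ, rfl⟩ := hf.exists_iso (isBaseChange_atlas g hG)
  exact ((An.isEtale_of_isIso θ.hom).comp (isEtale_projTo (g.w_obj _))).isSubmersion

/-- A local section of the bundle trivialises it; the corresponding map to `X` is the section
followed by `P.toX`. -/
theorem isSurjective_atlas : IsSurjective (atlas hG ρ) := by
  rintro _ a rfl
  let P : QuotientObj ρ := a
  have h (s : P.base) : ∃ (V : Opens P.base) (σ : P.base.openSub V ⟶ P.bundle.total), s ∈ V ∧
      σ ≫ P.bundle.proj = P.base.incl V :=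
    let ⟨V, σ, hs, hσ, _⟩ := P.bundle.locally_trivial s
    ⟨V, σ, hs, hσ⟩
  choose V σ hs hσ using h
  refine ⟨P.base, V, eq_top_iff.2 fun s _ => Opens.mem_iSup.2 ⟨s, hs s⟩, fun s =>
    ⟨Over.mk (σ s ≫ P.toX), ?_⟩⟩
  let φ : QuotientHom (atlasObj hG ρ (Over.mk (σ s ≫ P.toX))) P :=
    atlasDesc hG (P.base.incl (V s)) (σ s) (hσ s) rfl
  exact ⟨φ, CategoryTheory.IsHomLift.map (quotientStack ρ).p φ⟩

theorem isAnalyticStack_quotientStack : IsAnalyticStack (quotientStack ρ) (atlas hG ρ) :=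
  ⟨isStack_quotientStack ρ, isRepresentable_atlas hG, isSurjective_atlas hG,
    isStackSubmersion_atlas hG⟩

end

end

end OrbiStack

/-! ### Reduction of the structure group along an invariant open set. -/

namespace OrbiStack

noncomputable section

open CategoryTheory.Functor

/-- A map to an open subset. -/
def An.codRestrict {S T : An.{u}} (f : S ⟶ T) (V : Opens T) (h : ∀ s, f.toFun s ∈ V) :
    S ⟶ T.openSub V :=
  ⟨fun s => (⟨f.toFun s, h s⟩ : V),
    (isEtale_incl T V).analytic_lift (f.continuous.subtype_mk h) f.analytic⟩

theorem An.codRestrict_incl {S T : An.{u}} (f : S ⟶ T) (V : Opens T) (h : ∀ s, f.toFun s ∈ V) :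
    An.codRestrict f V h ≫ T.incl V = f := rfl

theorem An.incl_cancel {S T : An.{u}} {V : Opens T} {f g : S ⟶ T.openSub V}
    (h : f ≫ T.incl V = g ≫ T.incl V) : f = g :=
  An.hom_ext fun s => Subtype.ext (congrFun (congrArg An.Hom.toFun h) s)

variable {G : Type u} [Group G] {X : An.{u}} {ρ : RightAction G X} {H : Subgroup G} {Y : Opens X}
  {hY : ∀ h ∈ H, ∀ y ∈ Y, ρ.act h y ∈ Y}

section Reduction

variable (hY) (hY' : ∀ g ∉ H, ∀ y ∈ Y, ρ.act g y ∉ Y) (R : QuotientObj ρ)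
  (hR : ∀ s, ∃ q, R.bundle.proj.toFun q = s ∧ R.toX.toFun q ∈ Y)

/-- The preimage of `Y` in the total space of a bundle. -/
def reductionSet (Y : Opens X) : Opens R.bundle.total :=
  ⟨R.toX.toFun ⁻¹' Y, Y.2.preimage R.toX.continuous⟩

theorem toX_act (g : G) (q : R.bundle.total) :
    R.toX.toFun ((R.bundle.action.act g).toFun q) = (ρ.act g).toFun (R.toX.toFun q) :=
  congrFun (congrArg An.Hom.toFun (R.equivariant g)) q

include hY in
theorem act_mem_reductionSet : ∀ h ∈ H, ∀ q ∈ reductionSet R Y,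
    R.bundle.action.act h q ∈ reductionSet R Y := fun h hh q hq => by
  change R.toX.toFun ((R.bundle.action.act h).toFun q) ∈ Y
  rw [toX_act]
  exact hY h hh _ hq

/-- The reduction of the structure group of a bundle to `H`, given by the preimage of `Y`. -/
def reduction : QuotientObj (ρ.restrict H Y hY) where
  base := R.base
  bundle := .ofEtale (R.bundle.total.incl (reductionSet R Y) ≫ R.bundle.proj)
    (R.bundle.action.restrict H (reductionSet R Y) (act_mem_reductionSet hY R))
    (fun a => congrArg (R.bundle.total.incl (reductionSet R Y) ≫ ·) (R.bundle.act_proj a))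
    ((An.isEtale_incl _ _).comp R.bundle.isEtale_proj)
    (fun s => let ⟨q, hq, hq'⟩ := hR s; ⟨(⟨q, hq'⟩ : reductionSet R Y), hq⟩)
    (by
      rintro ⟨q, hq⟩ ⟨q', hq'⟩ h
      obtain ⟨g, hg, hu⟩ := R.bundle.existsUnique_act (q := q) (q' := q') h
      -- Two points of a fibre that both map into `Y` differ by some `g` that carries a point of `Y`
      -- into `Y`; by disjointness such a `g` lies in `H`.
      have hgH : g ∈ H := by
        by_contra hn
        refine hY' g hn _ hq ?_
        rw [← toX_act, hg]
        exact hq'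
      exact ⟨⟨g, hgH⟩, Subtype.ext hg, fun a ha => Subtype.ext (hu a (congrArg Subtype.val ha))⟩)
  toX := An.codRestrict (R.bundle.total.incl (reductionSet R Y) ≫ R.toX) Y fun q => q.2
  equivariant a := An.incl_cancel
    (congrArg (R.bundle.total.incl (reductionSet R Y) ≫ ·) (R.equivariant a))

variable (hG : Nonempty X → Countable G)

/-- The canonical morphism from the extension of a reduction to the bundle. -/
def reductionHom : (extensionFunctor hG H Y hY).obj (reduction hY hY' R hR) ⟶ R :=
  show QuotientHom (extensionFunctorObj hG H Y hY (reduction hY hY' R hR)) R from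
    extensionDesc (Q := (reduction hY hY' R hR).bundle) _ _ (𝟙 R.base)
    (R.bundle.total.incl (reductionSet R Y)) rfl (fun _ => rfl) rfl

theorem unitMap_reductionHom : unitMap hG H Y hY _ ≫ QuotientHom.total (reductionHom hY hY' R hR hG) =
    R.bundle.total.incl (reductionSet R Y) :=
  extensionIncl_desc (Q := (reduction hY hY' R hR).bundle) _ _ _ _ rfl (fun _ => rfl) rfl

theorem isHomLift_reductionHom {T : An.{u}} (h : R.base = T) :
    (quotientStack ρ).p.IsHomLift (𝟙 T) (reductionHom hY hY' R hR hG) := by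
  subst h
  exact CategoryTheory.IsHomLift.map (quotientStack ρ).p (reductionHom hY hY' R hR hG)

variable {R}

theorem toX_unitMap_mem {b : QuotientObj (ρ.restrict H Y hY)}
    (ψ : QuotientHom (extensionFunctorObj hG H Y hY b) R) (q : b.bundle.total) :
    R.toX.toFun (ψ.total.toFun ((unitMap hG H Y hY b).toFun q)) ∈ Y := by
  rw [ψ.toX_total]
  have : (extensionFunctorObj hG H Y hY b).toX.toFun ((unitMap hG H Y hY b).toFun q) =
    (X.incl Y).toFun (b.toX.toFun q) := congrFun (congrArg An.Hom.toFun (unitMap_toX hG H Y hY b)) q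
  rw [this]
  exact (b.toX.toFun q : Y).2

/-- Morphisms from an extension to a bundle factor through its reduction. -/
theorem exists_hom_reduction {b : (quotientStack (ρ.restrict H Y hY)).obj}
    (ψ : (extensionFunctor hG H Y hY).obj b ⟶ R) :
    ∃ m : b ⟶ reduction hY hY' R hR,
      (extensionFunctor hG H Y hY).map m ≫ reductionHom hY hY' R hR hG = ψ := by
  revert b
  intro (b : QuotientObj (ρ.restrict H Y hY)) (ψ : QuotientHom (extensionFunctorObj hG H Y hY b) R)
  let k : b.bundle.total ⟶ R.bundle.total := unitMap hG H Y hY b ≫ ψ.total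
  have hact (a : H) : b.bundle.action.act a ≫ k = k ≫ R.bundle.action.act a := by
    refine (congrArg (· ≫ ψ.total) (unitMap_act hG H Y hY b a)).trans ?_
    exact congrArg (unitMap hG H Y hY b ≫ ·) (ψ.equivariant a)
  have hX : k ≫ R.toX = b.toX ≫ X.incl Y :=
    (congrArg (unitMap hG H Y hY b ≫ ·) ψ.toX).trans (unitMap_toX hG H Y hY b)
  let m : QuotientHom b (reduction hY hY' R hR) :=
    { base := ψ.base
      total := An.codRestrict k (reductionSet R Y) (toX_unitMap_mem hY hG ψ)
      comm := congrArg (unitMap hG H Y hY b ≫ ·) ψ.comm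
      equivariant := fun a => An.incl_cancel (hact a)
      toX := An.incl_cancel hX }
  refine ⟨m, extensionFunctor_hom_ext ?_⟩
  refine (congrArg (· ≫ QuotientHom.total (reductionHom hY hY' R hR hG)) (unitMap_map hG H Y hY m)).trans ?_
  exact congrArg (m.total ≫ ·) (unitMap_reductionHom hY hY' R hR hG)

end Reduction

section

variable (hG : Nonempty X → Countable G)

/-- The unit maps are natural, and they are injective as inclusions of the copy indexed by `1`. -/
theorem extensionFunctor_faithful {b b' : (quotientStack (ρ.restrict H Y hY)).obj} {m m' : b ⟶ b'}
    (h : (extensionFunctor hG H Y hY).map m = (extensionFunctor hG H Y hY).map m') : m = m' := by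
  refine QuotientHom.ext_total fun q => ?_
  have h1 : QuotientHom.total m ≫ unitMap hG H Y hY b' =
      QuotientHom.total m' ≫ unitMap hG H Y hY b' :=
    (unitMap_map hG H Y hY m).symm.trans
      ((congrArg (unitMap hG H Y hY b ≫ QuotientHom.total ·) h).trans (unitMap_map hG H Y hY m'))
  exact eq_of_heq (Sigma.mk.inj (congrFun (congrArg An.Hom.toFun h1) q)).2

end

end

end OrbiStack

/-! ### The open substacks `[Y/H]`, their covering property, and countability of `G`. -/

namespace OrbiStack

noncomputable section

open CategoryTheory.Functor

variable {G : Type u} [Group G] {X : An.{u}} {ρ : RightAction G X}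

section OpenSubstack

variable {H : Subgroup G} {Y : Opens X}
  (hY : ∀ h ∈ H, ∀ y ∈ Y, ρ.act h y ∈ Y) (hY' : ∀ g ∉ H, ∀ y ∈ Y, ρ.act g y ∉ Y)
  (hG : Nonempty X → Countable G) {S : An.{u}} (g : S.toStack ⥤ᵇ quotientStack ρ)

/-- The set of the points over which the bundle that is classified by `g` meets the preimage
of `Y`. -/
def locus (Y : Opens X) : Opens S :=
  ⟨(classifiedProj g).toFun '' reductionSet (g.obj (Over.mk (𝟙 S)) : QuotientObj ρ) Y,
    (isEtale_projTo (g.w_obj _)).isLocalHomeomorph.isOpenMap _ (reductionSet _ Y).2⟩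

/-- The restriction morphism is surjective on fibres and compatible with the maps to `X`, so points
over `Y` lift to the pulled-back bundle. This supplies the hypothesis under which reductions exist.
-/
theorem exists_mem_of_locus {y : Over S} (h : ∀ t, y.hom.toFun t ∈ locus g Y)
    (s : QuotientObj.base (g.obj y)) : ∃ q, (QuotientObj.bundle (g.obj y)).proj.toFun q = s ∧
      (QuotientObj.toX (g.obj y)).toFun q ∈ Y := by
  obtain ⟨q, rfl⟩ := (QuotientObj.bundle (g.obj y)).proj_surjective s
  obtain ⟨p, hp, e⟩ := h ((projTo (g.w_obj y)).toFun q)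
  obtain ⟨q', h1, h2⟩ := exists_totalMap_eq y.hom (restrictionHom g y) (g.w_obj y)
    (g.w_obj (Over.mk (𝟙 S))) e.symm
  refine ⟨q', ?_, ?_⟩
  · obtain ⟨a, ha, -⟩ := existsUnique_act_of_projTo (g.w_obj y) h1
    rw [← ha, PrincipalBundle.proj_act]
  · rw [← toX_totalMap (restrictionHom g y), h2]
    exact hp

theorem mem_locus {y : Over S} {b : (quotientStack (ρ.restrict H Y hY)).obj}
    (ψ : (extensionFunctor hG H Y hY).obj b ⟶ g.obj y)
    [(quotientStack ρ).p.IsHomLift (𝟙 y.left) ψ] (t : y.left) : y.hom.toFun t ∈ locus g Y := by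
  have hb : (quotientStack ρ).p.obj ((extensionFunctor hG H Y hY).obj b) = y.left :=
    IsHomLift.domain_eq (quotientStack ρ).p (𝟙 y.left) ψ
  obtain ⟨q, hq⟩ := projTo_surjective (ρ := ρ.restrict H Y hY) (a := b) hb t
  have hq' : (projTo hb).toFun ((unitMap hG H Y hY b).toFun q) = t := hq
  refine ⟨totalMap (restrictionHom g y) (totalMap ψ ((unitMap hG H Y hY b).toFun q)), ?_, ?_⟩
  · change (QuotientObj.toX _).toFun (totalMap (restrictionHom g y) _) ∈ Y
    rw [toX_totalMap]
    exact toX_unitMap_mem hY hG ψ q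
  · refine (projTo_totalMap y.hom (restrictionHom g y) (g.w_obj y) (g.w_obj (Over.mk (𝟙 S))) _).trans
      (congrArg y.hom.toFun ?_)
    exact (projTo_totalMap (𝟙 y.left) ψ hb (g.w_obj y) _).trans hq'

include hY' in
-- Over the locus, the preimage of `Y` is an `H`-bundle whose extension is the given bundle.
-- Conversely, an `H`-bundle whose extension is a restriction of the given bundle lives over the
-- locus and maps to this reduction by a morphism over the identity, hence an isomorphism.
theorem isBaseChange_extensionFunctor :
    IsBaseChange (extensionFunctor hG H Y hY) g (S.incl (locus g Y)) := by
  have hR (m : Over (S.openSub (locus g Y))) :=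
    exists_mem_of_locus (Y := Y) (y := (Over.map (S.incl (locus g Y))).obj m) g
      fun t => (m.hom.toFun t : locus g Y).2
  let ε (m) := reductionHom hY hY' _ (hR m) hG
  have hε (m) : (quotientStack ρ).p.IsHomLift (𝟙 m.left) (ε m) :=
    isHomLift_reductionHom hY hY' _ (hR m) hG (g.w_obj _)
  have hi (m) : IsIso (ε m) := isIso_of_isHomLift_id (S := m.left) _
  refine isBaseChange_of_faithful (extensionFunctor_faithful hG)
    (fun m => reduction hY hY' _ (hR m)) (fun m => CategoryTheory.inv (ε m)) inferInstance
    (fun m => inferInstance) ?_ ?_ ?_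
  · intro m m' k
    obtain ⟨r, hr⟩ := exists_hom_reduction hY hY' (hR m') hG
      (ε m ≫ g.map ((Over.map (S.incl (locus g Y))).map k))
    refine ⟨r, ?_⟩
    rw [IsIso.comp_inv_eq, Category.assoc, IsIso.eq_inv_comp]
    exact hr.symm
  · intro m m' k r _
    -- The inclusion of the locus is a monomorphism, so compatibility over `S` suffices.
    exact An.incl_cancel (Over.w k)
  · intro s b ψ hψ hψ'
    let m : s.left ⟶ S.openSub (locus g Y) :=
      An.codRestrict s.hom _ fun t => mem_locus hY hG g (CategoryTheory.inv ψ) t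
    let l : (Over.map (S.incl (locus g Y))).obj (Over.mk m) ≅ s :=
      Over.isoMk (Iso.refl _) (Category.id_comp _)
    obtain ⟨r, hr⟩ := exists_hom_reduction hY hY' (hR (Over.mk m)) hG
      (CategoryTheory.inv ψ ≫ g.map l.inv)
    have hl : (quotientStack ρ).p.IsHomLift (𝟙 s.left) (g.map l.inv) := isHomLift_map g l.inv
    have h1 : (quotientStack ρ).p.IsHomLift (𝟙 s.left) ((extensionFunctor hG H Y hY).map r) := by
      rw [(IsIso.eq_comp_inv _).2 hr]
      have := hε (Over.mk m)
      have : (quotientStack ρ).p.IsHomLift (𝟙 s.left) (CategoryTheory.inv (ε (Over.mk m))) :=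
        inferInstanceAs
          ((quotientStack ρ).p.IsHomLift (𝟙 (Over.mk m).left) (CategoryTheory.inv (ε (Over.mk m))))
      infer_instance
    -- Extension of the structure group does not change bases, so `r` covers the identity because
    -- its extension does.
    have h2 : (quotientStack (ρ.restrict H Y hY)).p.IsHomLift (𝟙 s.left) r :=
      (BasedFunctor.isHomLift_iff (extensionFunctor hG H Y hY) _ _).1 h1
    have h3 : IsIso r := isIso_of_isHomLift_id (S := s.left) r
    refine ⟨m, An.codRestrict_incl _ _ _, CategoryTheory.inv r, IsIso.inv_isIso, ?_⟩
    have h4 : g.map l.inv ≫ g.map l.hom = 𝟙 _ :=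
      (g.toFunctor.map_comp _ _).symm.trans
        ((congrArg g.toFunctor.map l.inv_hom_id).trans (g.toFunctor.map_id _))
    have h5 : (extensionFunctor hG H Y hY).map r ≫ ε (Over.mk m) ≫ g.map l.hom ≫ ψ = 𝟙 _ := by
      rw [← Category.assoc, hr, Category.assoc, ← Category.assoc (g.map l.inv), h4,
        Category.id_comp, IsIso.inv_hom_id]
    change g.map l.hom ≫ ψ = _
    rw [IsIso.eq_inv_comp]
    have h6 : IsIso ((extensionFunctor hG H Y hY).map r) :=
      (extensionFunctor hG H Y hY).toFunctor.map_isIso r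
    refine (IsIso.eq_inv_of_hom_inv_id h5).trans ?_
    exact ((extensionFunctor hG H Y hY).toFunctor.map_inv r).symm

theorem isOpenSubstack_extensionFunctor (hY' : ∀ g ∉ H, ∀ y ∈ Y, ρ.act g y ∉ Y) :
    IsOpenSubstack (extensionFunctor hG H Y hY) where
  isStack := isStack_quotientStack _
  representable _ g := ⟨_, _, isBaseChange_extensionFunctor hY hY' hG g⟩
  isOpenMap S M g f hf := by
    obtain ⟨θ, rfl⟩ := hf.exists_iso (isBaseChange_extensionFunctor hY hY' hG g)
    exact ((An.isEtale_of_isIso θ.hom).comp (An.isEtale_incl _ _)).isLocalHomeomorph.isOpenMap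

end OpenSubstack

/-- The open substacks `[Y i / H i]` of `[X/G]` cover `[X/G]` if the sets `Y i` cover `X`. -/
theorem isSurjective_disjointUnionDesc (hG : Nonempty X → Countable G) {ι : Type u}
    {H : ι → Subgroup G} {Y : ι → Opens X} (hY : ∀ i, ∀ h ∈ H i, ∀ y ∈ Y i, ρ.act h y ∈ Y i)
    (hY' : ∀ i, ∀ g ∉ H i, ∀ y ∈ Y i, ρ.act g y ∉ Y i) (hcov : ∀ x, ∃ i, x ∈ Y i) :
    IsSurjective (disjointUnionDesc fun i => extensionFunctor hG (H i) (Y i) (hY i)) := by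
  rintro _ a rfl
  let P : QuotientObj ρ := a
  choose q hq using P.bundle.proj_surjective
  choose i hi using fun s => hcov (P.toX.toFun (q s))
  -- Around `s`, use the set over which the bundle meets the preimage of a `Y i` that contains the
  -- image of some point above `s`; over this set the bundle reduces to `H i`.
  let V (s : P.base) : Opens P.base := ⟨P.bundle.proj.toFun '' reductionSet P (Y (i s)),
    P.bundle.isEtale_proj.isLocalHomeomorph.isOpenMap _ (reductionSet P (Y (i s))).2⟩
  refine ⟨P.base, V, eq_top_iff.2 fun s _ => Opens.mem_iSup.2 ⟨s, q s, hi s, hq s⟩, fun s => ?_⟩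
  let R : QuotientObj ρ := P.pullback (P.base.incl (V s))
  have hR (v : R.base) : ∃ p, R.bundle.proj.toFun p = v ∧ R.toX.toFun p ∈ Y (i s) := by
    obtain ⟨v, p, hp, rfl⟩ := v
    exact ⟨(⟨(⟨_, p, hp, rfl⟩, p), rfl⟩ : PullbackSpace P.bundle (P.base.incl (V s))), rfl, hp⟩
  let ε := reductionHom (hY (i s)) (hY' (i s)) R hR hG
  have h1 : (quotientStack ρ).p.IsHomLift (𝟙 R.base) ε := isHomLift_reductionHom _ _ _ _ _ rfl
  let k : R ⟶ P := P.pullbackHom (P.base.incl (V s))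
  have h2 : (quotientStack ρ).p.IsHomLift (P.base.incl (V s)) k :=
    CategoryTheory.IsHomLift.map (quotientStack ρ).p k
  exact ⟨⟨i s, reduction (hY (i s)) (hY' (i s)) R hR⟩, ε ≫ k,
    IsHomLift.comp_lift_id_left' (quotientStack ρ).p R.base ε (P.base.incl (V s)) k⟩

/-- A group that acts on a manifold is countable if there is a nonempty open set that is disjoint
from its translates by the elements outside a countable subgroup. -/
theorem countable_of_disjoint_translates {H : Subgroup G} [Countable H] {Y : Opens X}
    (hY' : ∀ g ∉ H, ∀ y ∈ Y, ρ.act g y ∉ Y) {x : X} (hx : x ∈ Y) : Countable G := by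
  have hT : Countable (transversal H) := by
    -- The sets are the translates `Y · t`. If those for `t` and `t'` meet, then `t * t'⁻¹` carries
    -- a point of `Y` into `Y`, hence lies in `H`, and the two representatives coincide. A second
    -- countable space has only countably many disjoint nonempty open sets.
    refine Set.countable_univ_iff.1 (Set.PairwiseDisjoint.countable_of_isOpen
      (s := fun t : transversal H => (ρ.act (t : G)⁻¹).toFun ⁻¹' Y) ?_ ?_ ?_)
    · rintro t - t' - hne
      refine Set.disjoint_left.2 fun z hz hz' => hne ?_
      have ha : (t * (t' : G)⁻¹ : G) ∈ H := by
        by_contra hn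
        refine hY' _ hn _ hz ?_
        rw [← RightAction.act_mul_apply, inv_mul_cancel_left]
        exact hz'
      have h := decompose_mul ⟨_, ha⟩ t'
      rw [show ((⟨_, ha⟩ : H) * t' : G) = t from inv_mul_cancel_right _ _, decompose_coe] at h
      exact congrArg Prod.snd h
    · exact fun t _ => Y.2.preimage (An.Hom.continuous _)
    · refine fun t _ => ⟨(ρ.act t).toFun x, ?_⟩
      change (ρ.act (t : G)⁻¹).toFun ((ρ.act t).toFun x) ∈ Y
      rwa [← RightAction.act_mul_apply, mul_inv_cancel, RightAction.act_one_apply]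
  exact (decompose H).injective.countable

end

end OrbiStack

theorem mainTheorem5 (X : An.{u}) (G : Type u) [Group G] (ρ : RightAction G X)
    (U : X → Opens X) (hxU : ∀ x, x ∈ U x)
    (hU : ∀ x, ∀ g ∈ ρ.stabilizer x, ∀ y ∈ U x, ρ.act g y ∈ U x)
    (hU' : ∀ x, ∀ g ∉ ρ.stabilizer x, ∀ y ∈ U x, ρ.act g y ∉ U x)
    (hfin : ∀ x, Finite (ρ.stabilizer x)) :
    ∃ (p : X.toStack ⥤ᵇ quotientStack ρ)
      (F : ∀ x : X, quotientStack (ρ.restrict (ρ.stabilizer x) (U x) (hU x)) ⥤ᵇ quotientStack ρ),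
      IsCanonicalAtlas ρ p ∧
      (∀ x, IsCanonicalMap ρ (ρ.stabilizer x) (U x) (hU x) (F x)) ∧
      IsAnalyticOrbifold (quotientStack ρ) p
        (fun x => ρ.restrict (ρ.stabilizer x) (U x) (hU x)) F := by
  -- Here finiteness of a stabiliser makes `G` countable, so that `X × G` and the extensions are
  -- second countable.
  have hG : Nonempty X → Countable G := fun ⟨x⟩ =>
    have := hfin x
    countable_of_disjoint_translates (hU' x) (hxU x)
  exact ⟨atlas hG ρ, fun x => extensionFunctor hG (ρ.stabilizer x) (U x) (hU x),
    isCanonicalAtlas_atlas hG, fun x => isCanonicalMap_extensionFunctor hG _ _ _,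
    { isAnalyticStack := isAnalyticStack_quotientStack hG
      finite := hfin
      isOpenSubstack := fun x => isOpenSubstack_extensionFunctor (hU x) hG (hU' x)
      surjective := isSurjective_disjointUnionDesc hG hU hU' fun x => ⟨x, hxU x⟩ }⟩
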